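/- Throughout, an *Ann-category* is a category $\mathcal A$ with (i) a bifunctor $\oplus$, an object $0$ and natural isomorphisms $a^+_{X,Y,Z}:X\oplus(Y\oplus Z)\to(X\oplus Y)\oplus Z$, $c_{X,Y}:X\oplus Y\to Y\oplus X$, $g_X:0\oplus X\to X$, $d_X:X\oplus 0\to X$ making $(\mathcal A,\oplus)$ a Pic-category, i.e. a symmetric monoidal category in which every morphism is an isomorphism and every object is invertible; (ii) a bifunctor $\otimes$ (written as juxtaposition on objects), an object $1$ and natural isomorphisms $a_{X,Y,Z}:X(YZ)\to(XY)Z$, $l_X:1X\to X$, $r_X:X1\to X$ making $(\mathcal A,\otimes)$ a monoidal category; (iii) natural isomorphisms $\mathfrak L_{A,X,Y}:A(X\oplus Y)\to AX\oplus AY$ and $\mathfrak R_{X,Y,A}:(X\oplus Y)A\to XA\oplus YA$ such that - for each $A$, the functors $(A\otimes -,\mathfrak L_{A,-,-})$ and $(-\otimes A,\mathfrak R_{-,-,A})$ are compatible with $a^+$ and $c$; - $\mathfrak L\circ a=(a\oplus a)\circ\mathfrak L\circ(\mathrm{id}\otimes\mathfrak L)$ on $A(B(X\oplus Y))$; $\mathfrak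 R\circ(\mathfrak R\otimes\mathrm{id})\circ a=(a\oplus a)\circ\mathfrak R$ on $(X\oplus Y)(AB)$; $\mathfrak R\circ(\mathfrak L\otimes\mathrm{id})\circ a=(a\oplus a)\circ\mathfrak L\circ(\mathrm{id}\otimes\mathfrak R)$ on $A((X\oplus Y)B)$; and $v\circ(\mathfrak R\oplus\mathfrak R)\circ\mathfrak L=(\mathfrak L\oplus\mathfrak L)\circ\mathfrak R$ on $(A\oplus B)(X\oplus Y)$, where $v:(P\oplus Q)\oplus(S\oplus T)\to(P\oplus S)\oplus(Q\oplus T)$ is the canonical isomorphism built from $a^+$ and $c$; - $(l_X\oplus l_Y)\circ\mathfrak L_{1,X,Y}=l_{X\oplus Y}$ and $(r_X\oplus r_Y)\circ\mathfrak R_{X,Y,1}=r_{X\oplus Y}$. An *Ann-functor* is a functor $F$ with natural isomorphisms $F(X\oplus Y)\to FX\oplus FY$, compatible with $a^+$ and $c$, and $F(XY)\to FX\,FY$, compatible with $a$, which together are compatible with $\mathfrak L$ and $\mathfrak R$. $\mathcal A$ is *Ann-equivalent* to $\mathcal B$ if there is an Ann-functor $\mathcal A\to\mathcal B$ that is an equivalence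 of categories. For an Ann-category $\mathcal A$, let $\Pi_0$ be the ring of isomorphism classes of objects (addition and multiplication induced by $\oplus$ and $\otimes$) and let $\Pi_1=\mathrm{Aut}(0)$, an abelian group written additively. $\Pi_1$ is a $\Pi_0$-bimodule: for $X\in s\in\Pi_0$ and $u\in\Pi_1$, $su$ (resp. $us$) is the automorphism of $0$ corresponding to $\mathrm{id}_X\otimes u$ on $X\otimes 0$ (resp. $u\otimes\mathrm{id}_X$ on $0\otimes X$) under an isomorphism $X\otimes0\cong0$ (resp. $0\otimes X\cong 0$); the choice of the isomorphism does not matter. Let $R$ be a ring with unit and $M$ an $R$-bimodule. An *Ann-category of type $(R,M)$* is given by functions $\xi,\alpha,\lambda,\rho:R^3\to M$ and $\eta:R^2\to M$ satisfying, for all $x,y,z,t\in R$: 1. $\xi(y,z,t)-\xi(x+y,z,t)+\xi(x,y+z,t)-\xi(x,y,z+t)+\xi(x,y,z)=0$ 2. $\xi(0,y,z)=\xi(x,0,t)=\xi(x,y,0)=0$ 3. $\xi(x,y,z)-\xi(x,z,y)+\xi(z,x,y)-\eta(x,z)+\eta(x+y,z)-\eta(y,z)=0$ 4. $\eta(x,y)+\eta(y,x)=0$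 5. $x\eta(y,z)-\eta(xy,xz)=\lambda(x,y,z)-\lambda(x,z,y)$ 6. $\eta(x,y)z-\eta(xz,yz)=\rho(x,y,z)-\rho(y,x,z)$ 7. $x\xi(y,z,t)-\xi(xy,xz,xt)=\lambda(x,z,t)-\lambda(x,y+z,t)+\lambda(x,y,z+t)-\lambda(x,y,z)$ 8. $\xi(x,y,z)t-\xi(xt,yt,zt)=\rho(y,z,t)-\rho(x+y,z,t)+\rho(x,y+z,t)-\rho(x,y,t)$ 9. $\rho(x,y,z+t)-\rho(x,y,z)-\rho(x,y,t)+\lambda(x,z,t)+\lambda(y,z,t)-\lambda(x+y,z,t)=-\xi(xz+xt,yz,yt)+\xi(xz,xt,yz)-\eta(xt,yz)+\xi(xz+yz,xt,yt)-\xi(xz,yz,xt)$ 10. $\alpha(x,y,z+t)-\alpha(x,y,z)-\alpha(x,y,t)=x\lambda(y,z,t)+\lambda(x,yz,yt)-\lambda(xy,z,t)$ 11. $\alpha(x,y+z,t)-\alpha(x,y,t)-\alpha(x,z,t)=x\rho(y,z,t)-\rho(xy,xz,t)+\lambda(x,yt,zt)-\lambda(x,y,z)t$ 12. $\alpha(x+y,z,t)-\alpha(x,z,t)-\alpha(y,z,t)=-\rho(x,y,z)t-\rho(xz,yz,t)+\rho(x,y,zt)$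 13. $x\alpha(y,z,t)-\alpha(xy,z,t)+\alpha(x,yz,t)-\alpha(x,y,zt)+\alpha(x,y,z)t=0$ 14. $\alpha(1,y,z)=\alpha(x,1,z)=\alpha(x,y,1)=0$ 15. $\alpha(0,y,z)=\alpha(x,0,z)=\alpha(x,y,0)=0$ 16. $\lambda(1,y,z)=\lambda(0,y,z)=\lambda(x,0,z)=\lambda(x,y,0)=0$ 17. $\rho(x,y,1)=\rho(0,y,z)=\rho(x,0,z)=\rho(x,y,0)=0$ Its objects are the elements of $R$; there are no morphisms between different objects and $\mathrm{Aut}(s)=\{s\}\times M$ with composition given by addition in $M$; the operations are $s\oplus t=s+t$, $(s,u)\oplus(t,v)=(s+t,u+v)$, $s\otimes t=st$, $(s,u)\otimes(t,v)=(st,sv+ut)$; the unit constraints $g,d,l,r$ are identities, and $a^+=\xi$, $c=\eta$, $a=\alpha$, $\mathfrak L=\lambda$, $\mathfrak R=\rho$. **Theorem.** Every Ann-category $\mathcal A$ is Ann-equivalent to an Ann-category of type $(R,M)$ with $R=\Pi_0$ and $M=\Pi_1$. -/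

import Mathlib

open CategoryTheory
open scoped RightActions

universe v v' u u'

set_option linter.unusedSimpArgs false

namespace Ann

/-- The data of two monoidal structures on one category: a symmetric one `⊕` (with associativity
constraint `a⁺`, commutativity constraint `c`, unit object `0` and unit constraints `g`, `d`) and
a further one `⊗` (with constraints `a`, `l`, `r` and unit object `1`). -/
class BimonoidalData (A : Type u) [Category.{v} A] where
  /-- the monoidal structure `(⊕, a⁺, (0, g, d))` -/
  addMonoidal : MonoidalCategory A
  /-- the commutativity constraint `c`, making `⊕` symmetric -/
  addSymmetric : @SymmetricCategory A _ addMonoidal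
  /-- the monoidal structure `(⊗, a, (1, l, r))` -/
  mulMonoidal : MonoidalCategory A

section Notation

variable {A : Type u} [Category.{v} A] [BimonoidalData A]

/-- `X ⊕ Y` on objects -/
abbrev addObj (X Y : A) : A :=
  (BimonoidalData.addMonoidal (A := A)).tensorObj X Y

/-- `X ⊗ Y` on objects -/
abbrev mulObj (X Y : A) : A :=
  (BimonoidalData.mulMonoidal (A := A)).tensorObj X Y

/-- `f ⊕ g` on morphisms -/
abbrev addMap {X Y X' Y' : A} (f : X ⟶ X') (g : Y ⟶ Y') : addObj X Y ⟶ addObj X' Y' :=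
  (BimonoidalData.addMonoidal (A := A)).tensorHom f g

/-- `f ⊗ g` on morphisms -/
abbrev mulMap {X Y X' Y' : A} (f : X ⟶ X') (g : Y ⟶ Y') : mulObj X Y ⟶ mulObj X' Y' :=
  (BimonoidalData.mulMonoidal (A := A)).tensorHom f g

end Notation

scoped infixr:65 " ⊕ₒ " => addObj
scoped infixr:70 " ⊗ₒ " => mulObj
scoped infixr:65 " ⊕ₕ " => addMap
scoped infixr:70 " ⊗ₕ " => mulMap

section Constraints

variable {A : Type u} [Category.{v} A] [BimonoidalData A]

variable (A) in
/-- the zero object `0` -/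
abbrev zeroObj : A := (BimonoidalData.addMonoidal (A := A)).tensorUnit

variable (A) in
/-- the unit object `1` -/
abbrev oneObj : A := (BimonoidalData.mulMonoidal (A := A)).tensorUnit

/-- `a⁺ : X ⊕ (Y ⊕ Z) ⟶ (X ⊕ Y) ⊕ Z` -/
abbrev addAssoc (X Y Z : A) : X ⊕ₒ (Y ⊕ₒ Z) ≅ (X ⊕ₒ Y) ⊕ₒ Z :=
  ((BimonoidalData.addMonoidal (A := A)).associator X Y Z).symm

/-- `c : X ⊕ Y ⟶ Y ⊕ X` -/
abbrev addComm (X Y : A) : X ⊕ₒ Y ≅ Y ⊕ₒ X :=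
  (BimonoidalData.addSymmetric (A := A)).braiding X Y

/-- `g : 0 ⊕ X ⟶ X` -/
abbrev zeroAdd (X : A) : zeroObj A ⊕ₒ X ≅ X :=
  (BimonoidalData.addMonoidal (A := A)).leftUnitor X

/-- `d : X ⊕ 0 ⟶ X` -/
abbrev addZero (X : A) : X ⊕ₒ zeroObj A ≅ X :=
  (BimonoidalData.addMonoidal (A := A)).rightUnitor X

/-- The interchange `v : (X ⊕ Y) ⊕ (Z ⊕ T) ⟶ (X ⊕ Z) ⊕ (Y ⊕ T)` built from `a⁺`, `c` and
identities. -/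
abbrev interchange (X Y Z T : A) : (X ⊕ₒ Y) ⊕ₒ (Z ⊕ₒ T) ⟶ (X ⊕ₒ Z) ⊕ₒ (Y ⊕ₒ T) :=
  letI := BimonoidalData.addMonoidal (A := A)
  letI := BimonoidalData.addSymmetric (A := A)
  MonoidalCategory.tensorμ X Y Z T

/-- `a : X ⊗ (Y ⊗ Z) ⟶ (X ⊗ Y) ⊗ Z` -/
abbrev mulAssoc (X Y Z : A) : X ⊗ₒ (Y ⊗ₒ Z) ≅ (X ⊗ₒ Y) ⊗ₒ Z :=
  ((BimonoidalData.mulMonoidal (A := A)).associator X Y Z).symm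

/-- `l : 1 ⊗ X ⟶ X` -/
abbrev oneMul (X : A) : oneObj A ⊗ₒ X ≅ X :=
  (BimonoidalData.mulMonoidal (A := A)).leftUnitor X

/-- `r : X ⊗ 1 ⟶ X` -/
abbrev mulOne (X : A) : X ⊗ₒ oneObj A ≅ X :=
  (BimonoidalData.mulMonoidal (A := A)).rightUnitor X

end Constraints

/-- An Ann-category: `⊕` makes `A` a Pic-category (a symmetric monoidal category in which every
morphism and every object is invertible), `⊗` makes it a monoidal category, and there are natural
distributivity isomorphisms `𝔏`, `ℜ` which are compatible with the other constraints. -/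
class AnnCategory (A : Type u) [Category.{v} A] extends BimonoidalData A where
  /-- every morphism is an isomorphism -/
  isIso_hom : ∀ {X Y : A} (f : X ⟶ Y), IsIso f
  /-- every object is invertible for `⊕` -/
  exists_neg : ∀ X : A, ∃ Y : A, Nonempty (X ⊕ₒ Y ≅ zeroObj A)
  /-- left distributivity `𝔏 : B ⊗ (X ⊕ Y) ⟶ (B ⊗ X) ⊕ (B ⊗ Y)` -/
  distribL : ∀ B X Y : A, B ⊗ₒ (X ⊕ₒ Y) ≅ (B ⊗ₒ X) ⊕ₒ (B ⊗ₒ Y)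
  /-- right distributivity `ℜ : (X ⊕ Y) ⊗ B ⟶ (X ⊗ B) ⊕ (Y ⊗ B)` -/
  distribR : ∀ X Y B : A, (X ⊕ₒ Y) ⊗ₒ B ≅ (X ⊗ₒ B) ⊕ₒ (Y ⊗ₒ B)
  distribL_naturality : ∀ {B B' X X' Y Y' : A} (f : B ⟶ B') (g : X ⟶ X') (h : Y ⟶ Y'),
    (f ⊗ₕ (g ⊕ₕ h)) ≫ (distribL B' X' Y').hom =
      (distribL B X Y).hom ≫ ((f ⊗ₕ g) ⊕ₕ (f ⊗ₕ h))
  distribR_naturality : ∀ {X X' Y Y' B B' : A} (g : X ⟶ X') (h : Y ⟶ Y') (f : B ⟶ B'),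
    ((g ⊕ₕ h) ⊗ₕ f) ≫ (distribR X' Y' B').hom =
      (distribR X Y B).hom ≫ ((g ⊗ₕ f) ⊕ₕ (h ⊗ₕ f))
  /-- `(B ⊗ -, 𝔏)` is compatible with `a⁺` -/
  distribL_addAssoc : ∀ B X Y Z : A,
    (distribL B X (Y ⊕ₒ Z)).hom ≫ (𝟙 (B ⊗ₒ X) ⊕ₕ (distribL B Y Z).hom) ≫
        (addAssoc (B ⊗ₒ X) (B ⊗ₒ Y) (B ⊗ₒ Z)).hom =
      (𝟙 B ⊗ₕ (addAssoc X Y Z).hom) ≫ (distribL B (X ⊕ₒ Y) Z).hom ≫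
        ((distribL B X Y).hom ⊕ₕ 𝟙 (B ⊗ₒ Z))
  /-- `(B ⊗ -, 𝔏)` is compatible with `c` -/
  distribL_addComm : ∀ B X Y : A,
    (distribL B X Y).hom ≫ (addComm (B ⊗ₒ X) (B ⊗ₒ Y)).hom =
      (𝟙 B ⊗ₕ (addComm X Y).hom) ≫ (distribL B Y X).hom
  /-- `(- ⊗ B, ℜ)` is compatible with `a⁺` -/
  distribR_addAssoc : ∀ X Y Z B : A,
    (distribR X (Y ⊕ₒ Z) B).hom ≫ (𝟙 (X ⊗ₒ B) ⊕ₕ (distribR Y Z B).hom) ≫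
        (addAssoc (X ⊗ₒ B) (Y ⊗ₒ B) (Z ⊗ₒ B)).hom =
      ((addAssoc X Y Z).hom ⊗ₕ 𝟙 B) ≫ (distribR (X ⊕ₒ Y) Z B).hom ≫
        ((distribR X Y B).hom ⊕ₕ 𝟙 (Z ⊗ₒ B))
  /-- `(- ⊗ B, ℜ)` is compatible with `c` -/
  distribR_addComm : ∀ X Y B : A,
    (distribR X Y B).hom ≫ (addComm (X ⊗ₒ B) (Y ⊗ₒ B)).hom =
      ((addComm X Y).hom ⊗ₕ 𝟙 B) ≫ (distribR Y X B).hom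
  mulAssoc_distribL : ∀ B C X Y : A,
    (mulAssoc B C (X ⊕ₒ Y)).hom ≫ (distribL (B ⊗ₒ C) X Y).hom =
      (𝟙 B ⊗ₕ (distribL C X Y).hom) ≫ (distribL B (C ⊗ₒ X) (C ⊗ₒ Y)).hom ≫
        ((mulAssoc B C X).hom ⊕ₕ (mulAssoc B C Y).hom)
  mulAssoc_distribR : ∀ X Y B C : A,
    (mulAssoc (X ⊕ₒ Y) B C).hom ≫ ((distribR X Y B).hom ⊗ₕ 𝟙 C) ≫
        (distribR (X ⊗ₒ B) (Y ⊗ₒ B) C).hom =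
      (distribR X Y (B ⊗ₒ C)).hom ≫ ((mulAssoc X B C).hom ⊕ₕ (mulAssoc Y B C).hom)
  mulAssoc_distribL_distribR : ∀ B X Y C : A,
    (mulAssoc B (X ⊕ₒ Y) C).hom ≫ ((distribL B X Y).hom ⊗ₕ 𝟙 C) ≫
        (distribR (B ⊗ₒ X) (B ⊗ₒ Y) C).hom =
      (𝟙 B ⊗ₕ (distribR X Y C).hom) ≫ (distribL B (X ⊗ₒ C) (Y ⊗ₒ C)).hom ≫
        ((mulAssoc B X C).hom ⊕ₕ (mulAssoc B Y C).hom)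
  distribL_distribR : ∀ B C X Y : A,
    (distribL (B ⊕ₒ C) X Y).hom ≫ ((distribR B C X).hom ⊕ₕ (distribR B C Y).hom) ≫
        interchange (B ⊗ₒ X) (C ⊗ₒ X) (B ⊗ₒ Y) (C ⊗ₒ Y) =
      (distribR B C (X ⊕ₒ Y)).hom ≫ ((distribL B X Y).hom ⊕ₕ (distribL C X Y).hom)
  distribL_one : ∀ X Y : A,
    (distribL (oneObj A) X Y).hom ≫ ((oneMul X).hom ⊕ₕ (oneMul Y).hom) =
      (oneMul (X ⊕ₒ Y)).hom
  distribR_one : ∀ X Y : A,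
    (distribR X Y (oneObj A)).hom ≫ ((mulOne X).hom ⊕ₕ (mulOne Y).hom) =
      (mulOne (X ⊕ₒ Y)).hom

open AnnCategory

/-! ### Ann-functors -/

/-- An Ann-functor: a functor with natural isomorphisms `F (X ⊕ Y) ⟶ F X ⊕ F Y` (compatible with
the associativity and commutativity constraints of `⊕`) and `F (X ⊗ Y) ⟶ F X ⊗ F Y` (compatible
with the associativity constraint of `⊗`), compatible with both distributivity constraints. -/
structure AnnFunctor (A : Type u) [Category.{v} A] [AnnCategory A]
    (B : Type u') [Category.{v'} B] [AnnCategory B] extends A ⥤ B where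
  mapAdd : ∀ X Y : A, obj (X ⊕ₒ Y) ≅ obj X ⊕ₒ obj Y
  mapMul : ∀ X Y : A, obj (X ⊗ₒ Y) ≅ obj X ⊗ₒ obj Y
  mapAdd_naturality : ∀ {X X' Y Y' : A} (f : X ⟶ X') (g : Y ⟶ Y'),
    map (f ⊕ₕ g) ≫ (mapAdd X' Y').hom = (mapAdd X Y).hom ≫ (map f ⊕ₕ map g)
  mapMul_naturality : ∀ {X X' Y Y' : A} (f : X ⟶ X') (g : Y ⟶ Y'),
    map (f ⊗ₕ g) ≫ (mapMul X' Y').hom = (mapMul X Y).hom ≫ (map f ⊗ₕ map g)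
  map_addAssoc : ∀ X Y Z : A,
    (mapAdd X (Y ⊕ₒ Z)).hom ≫ (𝟙 (obj X) ⊕ₕ (mapAdd Y Z).hom) ≫
        (addAssoc (obj X) (obj Y) (obj Z)).hom =
      map (addAssoc X Y Z).hom ≫ (mapAdd (X ⊕ₒ Y) Z).hom ≫ ((mapAdd X Y).hom ⊕ₕ 𝟙 (obj Z))
  map_addComm : ∀ X Y : A,
    (mapAdd X Y).hom ≫ (addComm (obj X) (obj Y)).hom =
      map (addComm X Y).hom ≫ (mapAdd Y X).hom
  map_mulAssoc : ∀ X Y Z : A,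
    (mapMul X (Y ⊗ₒ Z)).hom ≫ (𝟙 (obj X) ⊗ₕ (mapMul Y Z).hom) ≫
        (mulAssoc (obj X) (obj Y) (obj Z)).hom =
      map (mulAssoc X Y Z).hom ≫ (mapMul (X ⊗ₒ Y) Z).hom ≫ ((mapMul X Y).hom ⊗ₕ 𝟙 (obj Z))
  map_distribL : ∀ X Y Z : A,
    (mapMul X (Y ⊕ₒ Z)).hom ≫ (𝟙 (obj X) ⊗ₕ (mapAdd Y Z).hom) ≫
        (distribL (obj X) (obj Y) (obj Z)).hom =
      map (distribL X Y Z).hom ≫ (mapAdd (X ⊗ₒ Y) (X ⊗ₒ Z)).hom ≫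
        ((mapMul X Y).hom ⊕ₕ (mapMul X Z).hom)
  map_distribR : ∀ X Y Z : A,
    (mapMul (X ⊕ₒ Y) Z).hom ≫ ((mapAdd X Y).hom ⊗ₕ 𝟙 (obj Z)) ≫
        (distribR (obj X) (obj Y) (obj Z)).hom =
      map (distribR X Y Z).hom ≫ (mapAdd (X ⊗ₒ Z) (Y ⊗ₒ Z)).hom ≫
        ((mapMul X Z).hom ⊕ₕ (mapMul Y Z).hom)

/-- `A` is Ann-equivalent to `B`: there is an Ann-functor `A ⥤ B` which is an equivalence of
categories. -/
def AnnEquivalent (A : Type u) [Category.{v} A] [AnnCategory A]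
    (B : Type u') [Category.{v'} B] [AnnCategory B] : Prop :=
  ∃ F : AnnFunctor A B, F.toFunctor.IsEquivalence

/-! ### The ring `Π₀` and the bimodule `Π₁` -/

section Invariants

section Monoidal

open MonoidalCategory

variable {C : Type u} [Category.{v} C] [MonoidalCategory C]

theorem tensorHom_unit (f g : 𝟙_ C ⟶ 𝟙_ C) :
    (f ⊗ₘ g) ≫ (λ_ (𝟙_ C)).hom = (λ_ (𝟙_ C)).hom ≫ f ≫ g := by
  rw [MonoidalCategory.tensorHom_def, id_whiskerLeft, whiskerRight_id, unitors_equal,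
      unitors_inv_equal]
  simp

theorem unit_comm (f g : 𝟙_ C ⟶ 𝟙_ C) : f ≫ g = g ≫ f := by
  have h : (f ⊗ₘ g) ≫ (λ_ (𝟙_ C)).hom = (λ_ (𝟙_ C)).hom ≫ g ≫ f := by
    rw [MonoidalCategory.tensorHom_def', id_whiskerLeft, whiskerRight_id, unitors_equal,
      unitors_inv_equal]
    simp
  rw [tensorHom_unit] at h
  exact (cancel_epi _).1 h

end Monoidal

variable {A : Type u} [Category.{v} A]

variable (A) in
/-- `Π₀`: the set of isomorphism classes of objects -/
def Pi0 : Type u := Quotient (isIsomorphicSetoid A)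

/-- the isomorphism class of an object -/
def cl (X : A) : Pi0 A := Quotient.mk (isIsomorphicSetoid A) X

theorem cl_eq {X Y : A} (e : X ≅ Y) : cl X = cl Y :=
  Quotient.sound (s := isIsomorphicSetoid A) ⟨e⟩

theorem cl_exact {X Y : A} (h : cl X = cl Y) : Nonempty (X ≅ Y) :=
  Quotient.exact (s := isIsomorphicSetoid A) h

theorem Pi0.ind {p : Pi0 A → Prop} (h : ∀ X : A, p (cl X)) (s : Pi0 A) : p s :=
  Quotient.ind (s := isIsomorphicSetoid A) h s

variable [AnnCategory A]

/-- `⊕` of isomorphisms -/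
def addMapIso {X X' Y Y' : A} (e : X ≅ X') (e' : Y ≅ Y') : X ⊕ₒ Y ≅ X' ⊕ₒ Y' :=
  letI := BimonoidalData.addMonoidal (A := A)
  MonoidalCategory.tensorIso e e'

/-- `⊗` of isomorphisms -/
def mulMapIso {X X' Y Y' : A} (e : X ≅ X') (e' : Y ≅ Y') : X ⊗ₒ Y ≅ X' ⊗ₒ Y' :=
  letI := BimonoidalData.mulMonoidal (A := A)
  MonoidalCategory.tensorIso e e'

theorem addMap_comp {X X' X'' Y Y' Y'' : A} (p : X ⟶ X') (q : Y ⟶ Y') (r : X' ⟶ X'')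
    (s : Y' ⟶ Y'') : (p ⊕ₕ q) ≫ (r ⊕ₕ s) = (p ≫ r) ⊕ₕ (q ≫ s) :=
  (BimonoidalData.addMonoidal (A := A)).tensorHom_comp_tensorHom p q r s

theorem mulMap_comp {X X' X'' Y Y' Y'' : A} (p : X ⟶ X') (q : Y ⟶ Y') (r : X' ⟶ X'')
    (s : Y' ⟶ Y'') : (p ⊗ₕ q) ≫ (r ⊗ₕ s) = (p ≫ r) ⊗ₕ (q ≫ s) :=
  (BimonoidalData.mulMonoidal (A := A)).tensorHom_comp_tensorHom p q r s

theorem addMap_id (X Y : A) : (𝟙 X ⊕ₕ 𝟙 Y) = 𝟙 (X ⊕ₒ Y) :=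
  (BimonoidalData.addMonoidal (A := A)).id_tensorHom_id X Y

theorem mulMap_id (X Y : A) : (𝟙 X ⊗ₕ 𝟙 Y) = 𝟙 (X ⊗ₒ Y) :=
  (BimonoidalData.mulMonoidal (A := A)).id_tensorHom_id X Y

theorem mulAssoc_naturality {X X' Y Y' Z Z' : A} (p : X ⟶ X') (q : Y ⟶ Y') (r : Z ⟶ Z') :
    (p ⊗ₕ (q ⊗ₕ r)) ≫ (mulAssoc X' Y' Z').hom = (mulAssoc X Y Z).hom ≫ ((p ⊗ₕ q) ⊗ₕ r) := by
  let _ := BimonoidalData.mulMonoidal (A := A)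
  exact MonoidalCategory.associator_inv_naturality p q r

theorem oneMul_naturality {X Y : A} (p : X ⟶ Y) :
    (𝟙 (oneObj A) ⊗ₕ p) ≫ (oneMul Y).hom = (oneMul X).hom ≫ p := by
  let _ := BimonoidalData.mulMonoidal (A := A)
  have h := MonoidalCategory.leftUnitor_naturality p
  rwa [← MonoidalCategory.id_tensorHom] at h

theorem mulOne_naturality {X Y : A} (p : X ⟶ Y) :
    (p ⊗ₕ 𝟙 (oneObj A)) ≫ (mulOne Y).hom = (mulOne X).hom ≫ p := by
  let _ := BimonoidalData.mulMonoidal (A := A)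
  have h := MonoidalCategory.rightUnitor_naturality p
  rwa [← MonoidalCategory.tensorHom_id] at h

theorem addMap_zero (p q : zeroObj A ⟶ zeroObj A) :
    (p ⊕ₕ q) ≫ (zeroAdd (zeroObj A)).hom = (zeroAdd (zeroObj A)).hom ≫ p ≫ q := by
  let _ := BimonoidalData.addMonoidal (A := A)
  exact tensorHom_unit p q

theorem endZero_comm (p q : zeroObj A ⟶ zeroObj A) : p ≫ q = q ≫ p := by
  let _ := BimonoidalData.addMonoidal (A := A)
  exact unit_comm p q

instance : Zero (Pi0 A) := ⟨cl (zeroObj A)⟩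

instance : One (Pi0 A) := ⟨cl (oneObj A)⟩

/-- `cl X + cl Y = cl (X ⊕ Y)` -/
instance : Add (Pi0 A) :=
  ⟨Quotient.map₂ (fun X Y => X ⊕ₒ Y) fun _ _ h _ _ h' =>
    h.elim fun e => h'.elim fun e' => ⟨addMapIso e e'⟩⟩

/-- `cl X * cl Y = cl (X ⊗ Y)` -/
instance : Mul (Pi0 A) :=
  ⟨Quotient.map₂ (fun X Y => X ⊗ₒ Y) fun _ _ h _ _ h' =>
    h.elim fun e => h'.elim fun e' => ⟨mulMapIso e e'⟩⟩

theorem cl_zero : cl (zeroObj A) = 0 := rfl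
theorem cl_one : cl (oneObj A) = 1 := rfl
theorem cl_add (X Y : A) : cl (X ⊕ₒ Y) = cl X + cl Y := rfl
theorem cl_mul (X Y : A) : cl (X ⊗ₒ Y) = cl X * cl Y := rfl

theorem Pi0.exists_neg (s : Pi0 A) : ∃ t : Pi0 A, t + s = 0 := by
  induction s using Pi0.ind with | _ X
  obtain ⟨Y, ⟨e⟩⟩ := AnnCategory.exists_neg X
  exact ⟨cl Y, cl_eq (addComm Y X ≪≫ e)⟩

noncomputable instance : Neg (Pi0 A) := ⟨fun s => (Pi0.exists_neg s).choose⟩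

noncomputable instance : AddCommGroup (Pi0 A) where
  add_assoc s t r := by
    induction s using Pi0.ind with | _ X
    induction t using Pi0.ind with | _ Y
    induction r using Pi0.ind with | _ Z
    exact (cl_eq (addAssoc X Y Z)).symm
  zero_add s := by
    induction s using Pi0.ind with | _ X
    exact cl_eq (zeroAdd X)
  add_zero s := by
    induction s using Pi0.ind with | _ X
    exact cl_eq (addZero X)
  neg_add_cancel s := (Pi0.exists_neg s).choose_spec
  add_comm s t := by
    induction s using Pi0.ind with | _ X
    induction t using Pi0.ind with | _ Y
    exact cl_eq (addComm X Y)
  nsmul := nsmulRec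
  zsmul := zsmulRec

theorem Pi0.mul_add (s t r : Pi0 A) : s * (t + r) = s * t + s * r := by
  induction s using Pi0.ind with | _ X
  induction t using Pi0.ind with | _ Y
  induction r using Pi0.ind with | _ Z
  exact cl_eq (distribL X Y Z)

theorem Pi0.add_mul (s t r : Pi0 A) : (s + t) * r = s * r + t * r := by
  induction s using Pi0.ind with | _ X
  induction t using Pi0.ind with | _ Y
  induction r using Pi0.ind with | _ Z
  exact cl_eq (distribR X Y Z)

/-- the ring of isomorphism classes of objects -/
noncomputable instance : Ring (Pi0 A) where
  __ := (inferInstance : AddCommGroup (Pi0 A))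
  left_distrib := Pi0.mul_add
  right_distrib := Pi0.add_mul
  zero_mul s := by
    have h := Pi0.add_mul (0 : Pi0 A) 0 s
    rw [add_zero] at h
    exact left_eq_add.1 h
  mul_zero s := by
    have h := Pi0.mul_add s (0 : Pi0 A) 0
    rw [add_zero] at h
    exact left_eq_add.1 h
  mul_assoc s t r := by
    induction s using Pi0.ind with | _ X
    induction t using Pi0.ind with | _ Y
    induction r using Pi0.ind with | _ Z
    exact (cl_eq (mulAssoc X Y Z)).symm
  one_mul s := by
    induction s using Pi0.ind with | _ X
    exact cl_eq (oneMul X)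
  mul_one s := by
    induction s using Pi0.ind with | _ X
    exact cl_eq (mulOne X)

variable (A) in
/-- `Π₁ = Aut(0)`, written additively -/
def Pi1 : Type v := Additive (Aut (zeroObj A))

/-- the automorphism of `0` underlying an element of `Π₁` -/
def Pi1.toAut (u : Pi1 A) : Aut (zeroObj A) := Additive.toMul u

/-- an automorphism of `0` as an element of `Π₁` -/
def Pi1.ofAut (u : Aut (zeroObj A)) : Pi1 A := Additive.ofMul u

theorem Pi1.ext {u w : Pi1 A} (h : u.toAut.hom = w.toAut.hom) : u = w :=
  Aut.ext h

instance : AddGroup (Pi1 A) := inferInstanceAs (AddGroup (Additive (Aut (zeroObj A))))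

theorem Pi1.add_hom (u w : Pi1 A) : (u + w).toAut.hom = u.toAut.hom ≫ w.toAut.hom :=
  endZero_comm w.toAut.hom u.toAut.hom

theorem Pi1.zero_hom : (0 : Pi1 A).toAut.hom = 𝟙 (zeroObj A) := rfl

instance : AddCommGroup (Pi1 A) where
  add_comm u w := Pi1.ext (by rw [Pi1.add_hom, Pi1.add_hom, endZero_comm])

theorem nonempty_mulZero (X : A) : Nonempty (X ⊗ₒ zeroObj A ≅ zeroObj A) :=
  cl_exact (mul_zero (cl X))

theorem nonempty_zeroMul (X : A) : Nonempty (zeroObj A ⊗ₒ X ≅ zeroObj A) :=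
  cl_exact (zero_mul (cl X))

/-- Transporting an endomorphism along isomorphisms to `0` does not depend on the isomorphism. -/
theorem transport_unique {Z : A} (k : Z ⟶ Z) (e e' : Z ≅ zeroObj A) {w w' : zeroObj A ⟶ zeroObj A}
    (h : k ≫ e.hom = e.hom ≫ w) (h' : k ≫ e'.hom = e'.hom ≫ w') : w = w' := by
  have h1 : w = e.inv ≫ k ≫ e.hom := by rw [h, Iso.inv_hom_id_assoc]
  have h2 : w' = e'.inv ≫ k ≫ e'.hom := by rw [h', Iso.inv_hom_id_assoc]
  have h3 := endZero_comm (e.inv ≫ k ≫ e.hom) (e.inv ≫ e'.hom)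
  simp only [Category.assoc, Iso.hom_inv_id_assoc] at h3
  rw [h1, h2, ← cancel_epi (e.inv ≫ e'.hom)]
  simp only [Category.assoc, Iso.hom_inv_id_assoc]
  exact h3.symm

/-- `λ_X(u)`: the automorphism of `0` that corresponds to `id ⊗ u : X ⊗ 0 ⟶ X ⊗ 0` under an
isomorphism `X ⊗ 0 ≅ 0`.  All isomorphisms give the same result, see `lamAct_spec`; one of them is
the isomorphism `L̂^X` that makes `X ⊗ -` a unital monoidal functor for `⊕`. -/
noncomputable def lamAct (X : A) (u : Pi1 A) : Pi1 A :=
  Pi1.ofAut ((nonempty_mulZero X).some.symm ≪≫ mulMapIso (Iso.refl X) u.toAut ≪≫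
    (nonempty_mulZero X).some)

/-- `ρ_X(u)`: the automorphism of `0` that corresponds to `u ⊗ id : 0 ⊗ X ⟶ 0 ⊗ X` under an
isomorphism `0 ⊗ X ≅ 0`.  All isomorphisms give the same result, see `rhoAct_spec`; one of them is
the isomorphism `R̂^X` that makes `- ⊗ X` a unital monoidal functor for `⊕`. -/
noncomputable def rhoAct (X : A) (u : Pi1 A) : Pi1 A :=
  Pi1.ofAut ((nonempty_zeroMul X).some.symm ≪≫ mulMapIso u.toAut (Iso.refl X) ≪≫
    (nonempty_zeroMul X).some)

theorem lamAct_some (X : A) (u : Pi1 A) :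
    (𝟙 X ⊗ₕ u.toAut.hom) ≫ (nonempty_mulZero X).some.hom =
      (nonempty_mulZero X).some.hom ≫ (lamAct X u).toAut.hom :=
  (Iso.hom_inv_id_assoc (nonempty_mulZero X).some _).symm

theorem rhoAct_some (X : A) (u : Pi1 A) :
    (u.toAut.hom ⊗ₕ 𝟙 X) ≫ (nonempty_zeroMul X).some.hom =
      (nonempty_zeroMul X).some.hom ≫ (rhoAct X u).toAut.hom :=
  (Iso.hom_inv_id_assoc (nonempty_zeroMul X).some _).symm

theorem lamAct_eq {X : A} {u w : Pi1 A} (e : X ⊗ₒ zeroObj A ≅ zeroObj A)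
    (h : (𝟙 X ⊗ₕ u.toAut.hom) ≫ e.hom = e.hom ≫ w.toAut.hom) : lamAct X u = w :=
  Pi1.ext (transport_unique _ _ e (lamAct_some X u) h)

theorem rhoAct_eq {X : A} {u w : Pi1 A} (e : zeroObj A ⊗ₒ X ≅ zeroObj A)
    (h : (u.toAut.hom ⊗ₕ 𝟙 X) ≫ e.hom = e.hom ≫ w.toAut.hom) : rhoAct X u = w :=
  Pi1.ext (transport_unique _ _ e (rhoAct_some X u) h)

/-- The defining square of `λ_X(u)` commutes for every isomorphism `X ⊗ 0 ≅ 0`. -/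
theorem lamAct_spec (X : A) (u : Pi1 A) (e : X ⊗ₒ zeroObj A ≅ zeroObj A) :
    (𝟙 X ⊗ₕ u.toAut.hom) ≫ e.hom = e.hom ≫ (lamAct X u).toAut.hom := by
  let w : Pi1 A := Pi1.ofAut (e.symm ≪≫ mulMapIso (Iso.refl X) u.toAut ≪≫ e)
  have h : (𝟙 X ⊗ₕ u.toAut.hom) ≫ e.hom = e.hom ≫ w.toAut.hom :=
    (Iso.hom_inv_id_assoc e _).symm
  rw [lamAct_eq e h, h]

/-- The defining square of `ρ_X(u)` commutes for every isomorphism `0 ⊗ X ≅ 0`. -/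
theorem rhoAct_spec (X : A) (u : Pi1 A) (e : zeroObj A ⊗ₒ X ≅ zeroObj A) :
    (u.toAut.hom ⊗ₕ 𝟙 X) ≫ e.hom = e.hom ≫ (rhoAct X u).toAut.hom := by
  let w : Pi1 A := Pi1.ofAut (e.symm ≪≫ mulMapIso u.toAut (Iso.refl X) ≪≫ e)
  have h : (u.toAut.hom ⊗ₕ 𝟙 X) ≫ e.hom = e.hom ≫ w.toAut.hom :=
    (Iso.hom_inv_id_assoc e _).symm
  rw [rhoAct_eq e h, h]

theorem lamAct_congr {X Y : A} (i : X ≅ Y) (u : Pi1 A) : lamAct X u = lamAct Y u := by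
  obtain ⟨e⟩ := nonempty_mulZero Y
  refine lamAct_eq (mulMapIso i (Iso.refl _) ≪≫ e) ?_
  have h := lamAct_spec Y u e
  change (𝟙 X ⊗ₕ u.toAut.hom) ≫ (i.hom ⊗ₕ 𝟙 _) ≫ e.hom = ((i.hom ⊗ₕ 𝟙 _) ≫ e.hom) ≫ _
  rw [Category.assoc, ← h, ← Category.assoc, ← Category.assoc, mulMap_comp, mulMap_comp]
  simp only [Category.id_comp, Category.comp_id]

theorem rhoAct_congr {X Y : A} (i : X ≅ Y) (u : Pi1 A) : rhoAct X u = rhoAct Y u := by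
  obtain ⟨e⟩ := nonempty_zeroMul Y
  refine rhoAct_eq (mulMapIso (Iso.refl _) i ≪≫ e) ?_
  have h := rhoAct_spec Y u e
  change (u.toAut.hom ⊗ₕ 𝟙 X) ≫ (𝟙 _ ⊗ₕ i.hom) ≫ e.hom = ((𝟙 _ ⊗ₕ i.hom) ≫ e.hom) ≫ _
  rw [Category.assoc, ← h, ← Category.assoc, ← Category.assoc, mulMap_comp, mulMap_comp]
  simp only [Category.id_comp, Category.comp_id]

theorem lamAct_add (X : A) (u w : Pi1 A) : lamAct X (u + w) = lamAct X u + lamAct X w := by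
  obtain ⟨e⟩ := nonempty_mulZero X
  refine lamAct_eq e ?_
  rw [Pi1.add_hom, Pi1.add_hom, ← Category.assoc, ← lamAct_spec X u e, Category.assoc,
    ← lamAct_spec X w e, ← Category.assoc, mulMap_comp, Category.comp_id]

theorem rhoAct_add (X : A) (u w : Pi1 A) : rhoAct X (u + w) = rhoAct X u + rhoAct X w := by
  obtain ⟨e⟩ := nonempty_zeroMul X
  refine rhoAct_eq e ?_
  rw [Pi1.add_hom, Pi1.add_hom, ← Category.assoc, ← rhoAct_spec X u e, Category.assoc,
    ← rhoAct_spec X w e, ← Category.assoc, mulMap_comp, Category.comp_id]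

theorem lamAct_zero (X : A) : lamAct X (0 : Pi1 A) = 0 := by
  have h := lamAct_add X (0 : Pi1 A) 0
  rw [add_zero] at h
  exact left_eq_add.1 h

theorem rhoAct_zero (X : A) : rhoAct X (0 : Pi1 A) = 0 := by
  have h := rhoAct_add X (0 : Pi1 A) 0
  rw [add_zero] at h
  exact left_eq_add.1 h

theorem lamAct_one (u : Pi1 A) : lamAct (oneObj A) u = u :=
  lamAct_eq (oneMul (zeroObj A)) (oneMul_naturality _)

theorem rhoAct_one (u : Pi1 A) : rhoAct (oneObj A) u = u :=
  rhoAct_eq (mulOne (zeroObj A)) (mulOne_naturality _)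

theorem lamAct_addObj (X Y : A) (u : Pi1 A) : lamAct (X ⊕ₒ Y) u = lamAct X u + lamAct Y u := by
  obtain ⟨e⟩ := nonempty_mulZero X
  obtain ⟨e'⟩ := nonempty_mulZero Y
  refine lamAct_eq (distribR X Y _ ≪≫ addMapIso e e' ≪≫ zeroAdd _) ?_
  change _ ≫ (distribR X Y _).hom ≫ (e.hom ⊕ₕ e'.hom) ≫ (zeroAdd _).hom =
    ((distribR X Y _).hom ≫ (e.hom ⊕ₕ e'.hom) ≫ (zeroAdd _).hom) ≫ _
  have h := distribR_naturality (𝟙 X) (𝟙 Y) u.toAut.hom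
  rw [addMap_id] at h
  rw [← Category.assoc, h]
  simp only [Category.assoc]
  rw [Pi1.add_hom, ← addMap_zero, ← Category.assoc (_ ⊕ₕ _) (_ ⊕ₕ _), addMap_comp,
    ← Category.assoc (_ ⊕ₕ _) (_ ⊕ₕ _), addMap_comp, lamAct_spec X u e, lamAct_spec Y u e']

theorem rhoAct_addObj (X Y : A) (u : Pi1 A) : rhoAct (X ⊕ₒ Y) u = rhoAct X u + rhoAct Y u := by
  obtain ⟨e⟩ := nonempty_zeroMul X
  obtain ⟨e'⟩ := nonempty_zeroMul Y
  refine rhoAct_eq (distribL _ X Y ≪≫ addMapIso e e' ≪≫ zeroAdd _) ?_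
  change _ ≫ (distribL _ X Y).hom ≫ (e.hom ⊕ₕ e'.hom) ≫ (zeroAdd _).hom =
    ((distribL _ X Y).hom ≫ (e.hom ⊕ₕ e'.hom) ≫ (zeroAdd _).hom) ≫ _
  have h := distribL_naturality u.toAut.hom (𝟙 X) (𝟙 Y)
  rw [addMap_id] at h
  rw [← Category.assoc, h]
  simp only [Category.assoc]
  rw [Pi1.add_hom, ← addMap_zero, ← Category.assoc (_ ⊕ₕ _) (_ ⊕ₕ _), addMap_comp,
    ← Category.assoc (_ ⊕ₕ _) (_ ⊕ₕ _), addMap_comp, rhoAct_spec X u e, rhoAct_spec Y u e']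

theorem lamAct_mulObj (X Y : A) (u : Pi1 A) : lamAct (X ⊗ₒ Y) u = lamAct X (lamAct Y u) := by
  obtain ⟨e⟩ := nonempty_mulZero X
  obtain ⟨e'⟩ := nonempty_mulZero Y
  refine lamAct_eq ((mulAssoc X Y _).symm ≪≫ mulMapIso (Iso.refl X) e' ≪≫ e) ?_
  change _ ≫ (mulAssoc X Y _).inv ≫ (𝟙 X ⊗ₕ e'.hom) ≫ e.hom =
    ((mulAssoc X Y _).inv ≫ (𝟙 X ⊗ₕ e'.hom) ≫ e.hom) ≫ _
  have h := mulAssoc_naturality (𝟙 X) (𝟙 Y) u.toAut.hom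
  rw [mulMap_id] at h
  rw [← cancel_epi (mulAssoc X Y _).hom, ← Category.assoc, ← h]
  simp only [Category.assoc, Iso.hom_inv_id_assoc]
  rw [← lamAct_spec X _ e, ← Category.assoc (_ ⊗ₕ _) (_ ⊗ₕ _), mulMap_comp,
    ← Category.assoc (_ ⊗ₕ _) (_ ⊗ₕ _), mulMap_comp, lamAct_spec Y u e']

theorem rhoAct_mulObj (X Y : A) (u : Pi1 A) : rhoAct (X ⊗ₒ Y) u = rhoAct Y (rhoAct X u) := by
  obtain ⟨e⟩ := nonempty_zeroMul Y
  obtain ⟨e'⟩ := nonempty_zeroMul X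
  refine rhoAct_eq (mulAssoc _ X Y ≪≫ mulMapIso e' (Iso.refl Y) ≪≫ e) ?_
  change _ ≫ (mulAssoc _ X Y).hom ≫ (e'.hom ⊗ₕ 𝟙 Y) ≫ e.hom =
    ((mulAssoc _ X Y).hom ≫ (e'.hom ⊗ₕ 𝟙 Y) ≫ e.hom) ≫ _
  have h := mulAssoc_naturality u.toAut.hom (𝟙 X) (𝟙 Y)
  rw [mulMap_id] at h
  rw [← Category.assoc, h]
  simp only [Category.assoc]
  rw [← rhoAct_spec Y _ e, ← Category.assoc (_ ⊗ₕ _) (_ ⊗ₕ _), mulMap_comp,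
    ← Category.assoc (_ ⊗ₕ _) (_ ⊗ₕ _), mulMap_comp, rhoAct_spec X u e']

theorem lamAct_rhoAct (X Y : A) (u : Pi1 A) :
    lamAct X (rhoAct Y u) = rhoAct Y (lamAct X u) := by
  obtain ⟨e⟩ := nonempty_mulZero X
  obtain ⟨e'⟩ := nonempty_zeroMul Y
  refine Pi1.ext (transport_unique (𝟙 X ⊗ₕ (u.toAut.hom ⊗ₕ 𝟙 Y))
    (mulMapIso (Iso.refl X) e' ≪≫ e)
    (mulAssoc X _ Y ≪≫ mulMapIso e (Iso.refl Y) ≪≫ e') ?_ ?_)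
  · change _ ≫ (𝟙 X ⊗ₕ e'.hom) ≫ e.hom = ((𝟙 X ⊗ₕ e'.hom) ≫ e.hom) ≫ _
    rw [Category.assoc, ← lamAct_spec X _ e, ← Category.assoc, mulMap_comp, ← Category.assoc,
      mulMap_comp, rhoAct_spec Y u e']
  · change _ ≫ (mulAssoc X _ Y).hom ≫ (e.hom ⊗ₕ 𝟙 Y) ≫ e'.hom =
      ((mulAssoc X _ Y).hom ≫ (e.hom ⊗ₕ 𝟙 Y) ≫ e'.hom) ≫ _
    rw [← Category.assoc, mulAssoc_naturality]
    simp only [Category.assoc]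
    rw [← rhoAct_spec Y _ e', ← Category.assoc (_ ⊗ₕ _) (_ ⊗ₕ _), mulMap_comp,
      ← Category.assoc (_ ⊗ₕ _) (_ ⊗ₕ _), mulMap_comp, lamAct_spec X u e]

/-- the left action `s u = λ_X(u)` for `X ∈ s` -/
noncomputable instance : SMul (Pi0 A) (Pi1 A) :=
  ⟨fun s u => Quotient.lift (s := isIsomorphicSetoid A) (fun X => lamAct X u)
    (fun _ _ h => h.elim fun i => lamAct_congr i u) s⟩

/-- the right action `u s = ρ_X(u)` for `X ∈ s` -/
noncomputable instance : SMul (Pi0 A)ᵐᵒᵖ (Pi1 A) :=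
  ⟨fun s u => Quotient.lift (s := isIsomorphicSetoid A) (fun X => rhoAct X u)
    (fun _ _ h => h.elim fun i => rhoAct_congr i u) s.unop⟩

theorem cl_smul (X : A) (u : Pi1 A) : cl X • u = lamAct X u := rfl

theorem smul_cl (X : A) (u : Pi1 A) : u <• cl X = rhoAct X u := rfl

theorem Pi1.add_smul' (s t : Pi0 A) (u : Pi1 A) : (s + t) • u = s • u + t • u := by
  induction s using Pi0.ind with | _ X
  induction t using Pi0.ind with | _ Y
  exact lamAct_addObj X Y u

theorem Pi1.smul_add' (s t : Pi0 A) (u : Pi1 A) : u <• (s + t) = u <• s + u <• t := by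
  induction s using Pi0.ind with | _ X
  induction t using Pi0.ind with | _ Y
  exact rhoAct_addObj X Y u

noncomputable instance : Module (Pi0 A) (Pi1 A) where
  one_smul u := lamAct_one u
  mul_smul s t u := by
    induction s using Pi0.ind with | _ X
    induction t using Pi0.ind with | _ Y
    exact lamAct_mulObj X Y u
  smul_zero s := by
    induction s using Pi0.ind with | _ X
    exact lamAct_zero X
  smul_add s u w := by
    induction s using Pi0.ind with | _ X
    exact lamAct_add X u w
  add_smul s t u := Pi1.add_smul' s t u
  zero_smul u := by
    have h := Pi1.add_smul' (0 : Pi0 A) 0 u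
    rw [add_zero] at h
    exact left_eq_add.1 h

noncomputable instance : Module (Pi0 A)ᵐᵒᵖ (Pi1 A) where
  one_smul u := rhoAct_one u
  mul_smul s t u := by
    induction s using MulOpposite.rec' with | _ s
    induction t using MulOpposite.rec' with | _ t
    induction s using Pi0.ind with | _ X
    induction t using Pi0.ind with | _ Y
    exact rhoAct_mulObj Y X u
  smul_zero s := by
    induction s using MulOpposite.rec' with | _ s
    induction s using Pi0.ind with | _ X
    exact rhoAct_zero X
  smul_add s u w := by
    induction s using MulOpposite.rec' with | _ s
    induction s using Pi0.ind with | _ X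
    exact rhoAct_add X u w
  add_smul s t u := Pi1.smul_add' s.unop t.unop u
  zero_smul u := by
    have h := Pi1.smul_add' (0 : Pi0 A) 0 u
    rw [add_zero] at h
    exact left_eq_add.1 h

/-- `(s u) t = s (u t)`: the two actions make `Π₁` a `Π₀`-bimodule. -/
instance : SMulCommClass (Pi0 A) (Pi0 A)ᵐᵒᵖ (Pi1 A) where
  smul_comm s t u := by
    induction t using MulOpposite.rec' with | _ t
    induction s using Pi0.ind with | _ X
    induction t using Pi0.ind with | _ Y
    exact lamAct_rhoAct X Y u

end Invariants

/-! ### Ann-categories of type `(R, M)` -/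

/-- The constraints of an Ann-category of type `(R, M)`: functions `ξ, η, α, λ, ρ` with values in
the `R`-bimodule `M` satisfying the coherence relations.  Here `m <• x` is the right action of
`x : R` on `m : M`. -/
structure TypeData (R : Type u) (M : Type v) [Ring R] [AddCommGroup M] [Module R M]
    [Module Rᵐᵒᵖ M] [SMulCommClass R Rᵐᵒᵖ M] where
  ξ : R → R → R → M
  η : R → R → M
  α : R → R → R → M
  lam : R → R → R → M
  rho : R → R → R → M
  ξ_pentagon : ∀ x y z t,
    ξ y z t - ξ (x + y) z t + ξ x (y + z) t - ξ x y (z + t) + ξ x y z = 0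
  ξ_zero_left : ∀ y z, ξ 0 y z = 0
  ξ_zero_mid : ∀ x t, ξ x 0 t = 0
  ξ_zero_right : ∀ x y, ξ x y 0 = 0
  ξ_η_hexagon : ∀ x y z, ξ x y z - ξ x z y + ξ z x y - η x z + η (x + y) z - η y z = 0
  η_symm : ∀ x y, η x y + η y x = 0
  lam_η : ∀ x y z, x • η y z - η (x * y) (x * z) = lam x y z - lam x z y
  rho_η : ∀ x y z, η x y <• z - η (x * z) (y * z) = rho x y z - rho y x z
  lam_ξ : ∀ x y z t, x • ξ y z t - ξ (x * y) (x * z) (x * t) =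
    lam x z t - lam x (y + z) t + lam x y (z + t) - lam x y z
  rho_ξ : ∀ x y z t, ξ x y z <• t - ξ (x * t) (y * t) (z * t) =
    rho y z t - rho (x + y) z t + rho x (y + z) t - rho x y t
  lam_rho : ∀ x y z t,
    rho x y (z + t) - rho x y z - rho x y t + lam x z t + lam y z t - lam (x + y) z t =
      -ξ (x * z + x * t) (y * z) (y * t) + ξ (x * z) (x * t) (y * z) - η (x * t) (y * z)
        + ξ (x * z + y * z) (x * t) (y * t) - ξ (x * z) (y * z) (x * t)
  α_lam : ∀ x y z t, α x y (z + t) - α x y z - α x y t =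
    x • lam y z t + lam x (y * z) (y * t) - lam (x * y) z t
  α_lam_rho : ∀ x y z t, α x (y + z) t - α x y t - α x z t =
    x • rho y z t - rho (x * y) (x * z) t + lam x (y * t) (z * t) - lam x y z <• t
  α_rho : ∀ x y z t, α (x + y) z t - α x z t - α y z t =
    -(rho x y z <• t) - rho (x * z) (y * z) t + rho x y (z * t)
  α_pentagon : ∀ x y z t,
    x • α y z t - α (x * y) z t + α x (y * z) t - α x y (z * t) + α x y z <• t = 0
  α_one_left : ∀ y z, α 1 y z = 0
  α_one_mid : ∀ x z, α x 1 z = 0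
  α_one_right : ∀ x y, α x y 1 = 0
  α_zero_left : ∀ y z, α 0 y z = 0
  α_zero_mid : ∀ x z, α x 0 z = 0
  α_zero_right : ∀ x y, α x y 0 = 0
  lam_one : ∀ y z, lam 1 y z = 0
  lam_zero_left : ∀ y z, lam 0 y z = 0
  lam_zero_mid : ∀ x z, lam x 0 z = 0
  lam_zero_right : ∀ x y, lam x y 0 = 0
  rho_one : ∀ x y, rho x y 1 = 0
  rho_zero_left : ∀ y z, rho 0 y z = 0
  rho_zero_mid : ∀ x z, rho x 0 z = 0
  rho_zero_right : ∀ x y, rho x y 0 = 0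

section TypeCategory

variable {R : Type u} {M : Type v} [Ring R] [AddCommGroup M] [Module R M]
    [Module Rᵐᵒᵖ M] [SMulCommClass R Rᵐᵒᵖ M]

/-- The category of type `(R, M)`: its objects are the elements of `R`. -/
structure TypeCat (f : TypeData R M) : Type u where
  toR : R

/-- A morphism `s ⟶ t` exists only for `s = t`; it is then a pair `(s, u)` with `u : M`. -/
@[ext]
structure TypeHom (f : TypeData R M) (s t : TypeCat f) : Type v where
  val : M
  eq : s.toR = t.toR

variable {f : TypeData R M}

/-- Composition of morphisms is addition in `M`. -/
instance : Category.{v} (TypeCat f) where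
  Hom s t := TypeHom f s t
  id _ := ⟨0, rfl⟩
  comp p q := ⟨p.val + q.val, p.eq.trans q.eq⟩
  id_comp _ := TypeHom.ext (zero_add _)
  comp_id _ := TypeHom.ext (add_zero _)
  assoc _ _ _ := TypeHom.ext (add_assoc _ _ _)

theorem typeHom_ext {s t : TypeCat f} {p q : s ⟶ t} (h : TypeHom.val p = TypeHom.val q) : p = q :=
  TypeHom.ext h

theorem typeHom_eq {s t : TypeCat f} (p : s ⟶ t) : s.toR = t.toR := TypeHom.eq p

@[simp] theorem id_val (s : TypeCat f) : TypeHom.val (𝟙 s) = 0 := rfl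

@[simp] theorem comp_val {s t r : TypeCat f} (p : s ⟶ t) (q : t ⟶ r) :
    TypeHom.val (p ≫ q) = TypeHom.val p + TypeHom.val q := rfl

/-- the isomorphism given by `u : M` -/
def typeIso {s t : TypeCat f} (h : s.toR = t.toR) (u : M) : s ≅ t where
  hom := ⟨u, h⟩
  inv := ⟨-u, h.symm⟩
  hom_inv_id := typeHom_ext (add_neg_cancel u)
  inv_hom_id := typeHom_ext (neg_add_cancel u)

@[simp] theorem typeIso_hom_val {s t : TypeCat f} (h : s.toR = t.toR) (u : M) :
    TypeHom.val (typeIso h u).hom = u := rfl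

@[simp] theorem typeIso_inv_val {s t : TypeCat f} (h : s.toR = t.toR) (u : M) :
    TypeHom.val (typeIso h u).inv = -u := rfl

/-- `s ⊕ t = s + t`, `(s, u) ⊕ (t, v) = (s + t, u + v)`, with `a⁺ = ξ` (so that the associator
`(x ⊕ y) ⊕ z ⟶ x ⊕ (y ⊕ z)` is `-ξ`) and identity unit constraints. -/
@[reducible]
def typeAddStruct (f : TypeData R M) : MonoidalCategoryStruct (TypeCat f) where
  tensorObj s t := ⟨s.toR + t.toR⟩
  tensorHom p q := ⟨TypeHom.val p + TypeHom.val q, congrArg₂ (· + ·) p.eq q.eq⟩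
  whiskerLeft s _ _ q := ⟨TypeHom.val q, congrArg (s.toR + ·) q.eq⟩
  whiskerRight p t := ⟨TypeHom.val p, congrArg (· + t.toR) p.eq⟩
  tensorUnit := ⟨0⟩
  associator x y z := typeIso (add_assoc x.toR y.toR z.toR) (-f.ξ x.toR y.toR z.toR)
  leftUnitor x := typeIso (zero_add x.toR) 0
  rightUnitor x := typeIso (add_zero x.toR) 0

/-- `s ⊗ t = s t`, `(s, u) ⊗ (t, v) = (s t, s v + u t)`, with `a = α` (so that the associator
`(x ⊗ y) ⊗ z ⟶ x ⊗ (y ⊗ z)` is `-α`) and identity unit constraints. -/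
@[reducible]
def typeMulStruct (f : TypeData R M) : MonoidalCategoryStruct (TypeCat f) where
  tensorObj s t := ⟨s.toR * t.toR⟩
  tensorHom {s _ t _} p q :=
    ⟨s.toR • TypeHom.val q + TypeHom.val p <• t.toR, congrArg₂ (· * ·) p.eq q.eq⟩
  whiskerLeft s _ _ q := ⟨s.toR • TypeHom.val q, congrArg (s.toR * ·) q.eq⟩
  whiskerRight p t := ⟨TypeHom.val p <• t.toR, congrArg (· * t.toR) p.eq⟩
  tensorUnit := ⟨1⟩
  associator x y z := typeIso (mul_assoc x.toR y.toR z.toR) (-f.α x.toR y.toR z.toR)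
  leftUnitor x := typeIso (one_mul x.toR) 0
  rightUnitor x := typeIso (mul_one x.toR) 0

@[reducible]
def typeAddMonoidal (f : TypeData R M) : MonoidalCategory (TypeCat f) :=
  @MonoidalCategory.ofTensorHom (TypeCat f) _ (typeAddStruct f)
    (id_tensorHom_id := fun _ _ => typeHom_ext (add_zero _))
    (id_tensorHom := fun _ _ _ _ => typeHom_ext (zero_add _))
    (tensorHom_id := fun _ _ => typeHom_ext (add_zero _))
    (tensorHom_comp_tensorHom := fun _ _ _ _ => typeHom_ext (add_add_add_comm _ _ _ _))
    (associator_naturality := fun {x y z x' y' z'} p q r => typeHom_ext <| by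
      change TypeHom.val p + TypeHom.val q + TypeHom.val r + -f.ξ x'.toR y'.toR z'.toR =
        -f.ξ x.toR y.toR z.toR + (TypeHom.val p + (TypeHom.val q + TypeHom.val r))
      rw [typeHom_eq p, typeHom_eq q, typeHom_eq r]
      abel)
    (leftUnitor_naturality := fun p => typeHom_ext <| by
      change (0 : M) + TypeHom.val p + 0 = 0 + TypeHom.val p
      abel)
    (rightUnitor_naturality := fun p => typeHom_ext <| by
      change TypeHom.val p + (0 : M) + 0 = 0 + TypeHom.val p
      abel)
    (pentagon := fun x y z t => typeHom_ext <| by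
      have h := f.ξ_pentagon x.toR y.toR z.toR t.toR
      change -f.ξ x.toR y.toR z.toR + 0 + (-f.ξ x.toR (y.toR + z.toR) t.toR +
          (0 + -f.ξ y.toR z.toR t.toR)) =
        -f.ξ (x.toR + y.toR) z.toR t.toR + -f.ξ x.toR y.toR (z.toR + t.toR)
      linear_combination (norm := abel) -h)
    (triangle := fun x y => typeHom_ext <| by
      change -f.ξ x.toR 0 y.toR + ((0 : M) + 0) = 0 + 0
      simp [f.ξ_zero_mid])

@[reducible]
def typeAddSymmetric (f : TypeData R M) : @SymmetricCategory (TypeCat f) _ (typeAddMonoidal f) :=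
  letI := typeAddMonoidal f
  { braiding := fun x y => typeIso (add_comm x.toR y.toR) (f.η x.toR y.toR)
    braiding_naturality_right := fun x y z q => typeHom_ext <| by
      change TypeHom.val q + f.η x.toR z.toR = f.η x.toR y.toR + TypeHom.val q
      rw [typeHom_eq q, add_comm]
    braiding_naturality_left := fun {x y} p z => typeHom_ext <| by
      change TypeHom.val p + f.η y.toR z.toR = f.η x.toR z.toR + TypeHom.val p
      rw [typeHom_eq p, add_comm]
    hexagon_forward := fun x y z => typeHom_ext <| by
      have h := f.ξ_η_hexagon y.toR z.toR x.toR
      have h1 := f.η_symm x.toR (y.toR + z.toR)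
      have h2 := f.η_symm x.toR y.toR
      have h3 := f.η_symm x.toR z.toR
      change -f.ξ x.toR y.toR z.toR + (f.η x.toR (y.toR + z.toR) + -f.ξ y.toR z.toR x.toR) =
        f.η x.toR y.toR + (-f.ξ y.toR x.toR z.toR + f.η x.toR z.toR)
      linear_combination (norm := abel) h1 - h2 - h3 - h
    hexagon_reverse := fun x y z => typeHom_ext <| by
      have h := f.ξ_η_hexagon x.toR y.toR z.toR
      change - -f.ξ x.toR y.toR z.toR + (f.η (x.toR + y.toR) z.toR + - -f.ξ z.toR x.toR y.toR) =
        f.η y.toR z.toR + (- -f.ξ x.toR z.toR y.toR + f.η x.toR z.toR)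
      linear_combination (norm := abel) h
    symmetry := fun x y => typeHom_ext (f.η_symm _ _) }

@[reducible]
def typeMulMonoidal (f : TypeData R M) : MonoidalCategory (TypeCat f) :=
  @MonoidalCategory.ofTensorHom (TypeCat f) _ (typeMulStruct f)
    (id_tensorHom_id := fun x y => typeHom_ext <| by
      change x.toR • (0 : M) + (0 : M) <• y.toR = 0
      simp)
    (id_tensorHom := fun x y y' p => typeHom_ext <| by
      change x.toR • TypeHom.val p + (0 : M) <• y.toR = x.toR • TypeHom.val p
      simp)
    (tensorHom_id := fun {x x'} p y => typeHom_ext <| by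
      change x.toR • (0 : M) + TypeHom.val p <• y.toR = TypeHom.val p <• y.toR
      simp)
    (tensorHom_comp_tensorHom := fun {x x' x'' y y' y''} p q r s => typeHom_ext <| by
      change x.toR • TypeHom.val q + TypeHom.val p <• y.toR +
          (x'.toR • TypeHom.val s + TypeHom.val r <• y'.toR) =
        x.toR • (TypeHom.val q + TypeHom.val s) + (TypeHom.val p + TypeHom.val r) <• y.toR
      rw [typeHom_eq p, typeHom_eq q, smul_add, smul_add]
      abel)
    (associator_naturality := fun {x y z x' y' z'} p q r => typeHom_ext <| by
      change (x.toR * y.toR) • TypeHom.val r +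
            (x.toR • TypeHom.val q + TypeHom.val p <• y.toR) <• z.toR +
            -f.α x'.toR y'.toR z'.toR =
        -f.α x.toR y.toR z.toR +
          (x.toR • (y.toR • TypeHom.val r + TypeHom.val q <• z.toR) +
            TypeHom.val p <• (y.toR * z.toR))
      rw [typeHom_eq p, typeHom_eq q, typeHom_eq r, smul_add, smul_add, mul_smul,
        MulOpposite.op_mul, mul_smul, smul_comm x'.toR (MulOpposite.op z'.toR)]
      abel)
    (leftUnitor_naturality := fun {x y} p => typeHom_ext <| by
      change (1 : R) • TypeHom.val p + (0 : M) <• x.toR + 0 = 0 + TypeHom.val p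
      simp)
    (rightUnitor_naturality := fun {x y} p => typeHom_ext <| by
      change x.toR • (0 : M) + TypeHom.val p <• (1 : R) + 0 = 0 + TypeHom.val p
      simp)
    (pentagon := fun x y z t => typeHom_ext <| by
      have h := f.α_pentagon x.toR y.toR z.toR t.toR
      change ((x.toR * y.toR) * z.toR) • (0 : M) + (-f.α x.toR y.toR z.toR) <• t.toR +
          (-f.α x.toR (y.toR * z.toR) t.toR +
            (x.toR • (-f.α y.toR z.toR t.toR) + (0 : M) <• ((y.toR * z.toR) * t.toR))) =
        -f.α (x.toR * y.toR) z.toR t.toR + -f.α x.toR y.toR (z.toR * t.toR)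
      rw [smul_zero, smul_zero, smul_neg, smul_neg]
      linear_combination (norm := abel) -h)
    (triangle := fun x y => typeHom_ext <| by
      change -f.α x.toR 1 y.toR + (x.toR • (0 : M) + (0 : M) <• (1 * y.toR)) =
        (x.toR * 1) • (0 : M) + (0 : M) <• y.toR
      simp [f.α_one_mid])

instance typeBimonoidal (f : TypeData R M) : BimonoidalData (TypeCat f) where
  addMonoidal := typeAddMonoidal f
  addSymmetric := typeAddSymmetric f
  mulMonoidal := typeMulMonoidal f

@[simp] theorem addObj_toR (x y : TypeCat f) : (x ⊕ₒ y).toR = x.toR + y.toR := rfl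
@[simp] theorem mulObj_toR (x y : TypeCat f) : (x ⊗ₒ y).toR = x.toR * y.toR := rfl
@[simp] theorem zeroObj_toR : (zeroObj (TypeCat f)).toR = 0 := rfl
@[simp] theorem oneObj_toR : (oneObj (TypeCat f)).toR = 1 := rfl
@[simp] theorem addMap_val {x y x' y' : TypeCat f} (p : x ⟶ x') (q : y ⟶ y') :
    TypeHom.val (p ⊕ₕ q) = TypeHom.val p + TypeHom.val q := rfl
@[simp] theorem mulMap_val {x y x' y' : TypeCat f} (p : x ⟶ x') (q : y ⟶ y') :
    TypeHom.val (p ⊗ₕ q) = x.toR • TypeHom.val q + TypeHom.val p <• y.toR := rfl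
@[simp] theorem addAssoc_val (x y z : TypeCat f) :
    TypeHom.val (addAssoc x y z).hom = f.ξ x.toR y.toR z.toR := neg_neg _
@[simp] theorem addComm_val (x y : TypeCat f) :
    TypeHom.val (addComm x y).hom = f.η x.toR y.toR := rfl
@[simp] theorem zeroAdd_val (x : TypeCat f) : TypeHom.val (zeroAdd x).hom = 0 := rfl
@[simp] theorem addZero_val (x : TypeCat f) : TypeHom.val (addZero x).hom = 0 := rfl
@[simp] theorem mulAssoc_val (x y z : TypeCat f) :
    TypeHom.val (mulAssoc x y z).hom = f.α x.toR y.toR z.toR := neg_neg _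
@[simp] theorem oneMul_val (x : TypeCat f) : TypeHom.val (oneMul x).hom = 0 := rfl
@[simp] theorem mulOne_val (x : TypeCat f) : TypeHom.val (mulOne x).hom = 0 := rfl

theorem interchange_val (x y z t : TypeCat f) :
    TypeHom.val (interchange x y z t) =
      -f.ξ (x.toR + z.toR) y.toR t.toR + f.ξ x.toR z.toR y.toR - f.η z.toR y.toR
        + f.ξ (x.toR + y.toR) z.toR t.toR - f.ξ x.toR y.toR z.toR := by
  have e : TypeHom.val (interchange x y z t) =
      -f.ξ x.toR y.toR (z.toR + t.toR) + (- -f.ξ y.toR z.toR t.toR + (f.η y.toR z.toR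
        + (-f.ξ z.toR y.toR t.toR + - -f.ξ x.toR z.toR (y.toR + t.toR)))) := rfl
  have h1 := f.ξ_pentagon x.toR y.toR z.toR t.toR
  have h2 := f.ξ_pentagon x.toR z.toR y.toR t.toR
  have h3 := f.η_symm y.toR z.toR
  rw [e]
  rw [add_comm z.toR y.toR] at h2
  linear_combination (norm := abel) h1 - h2 + h3

/-- The Ann-category of type `(R, M)` given by `ξ, η, α, λ, ρ`: the operations are as above, and
`a⁺ = ξ`, `c = η`, `a = α`, `𝔏 = λ`, `ℜ = ρ`. -/
instance typeAnnCategory (f : TypeData R M) : AnnCategory (TypeCat f) where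
  isIso_hom p := (typeIso (typeHom_eq p) (TypeHom.val p)).isIso_hom
  exists_neg x := ⟨⟨-x.toR⟩, ⟨typeIso (add_neg_cancel x.toR) 0⟩⟩
  distribL x y z := typeIso (mul_add x.toR y.toR z.toR) (f.lam x.toR y.toR z.toR)
  distribR x y z := typeIso (add_mul x.toR y.toR z.toR) (f.rho x.toR y.toR z.toR)
  distribL_naturality p q r := typeHom_ext <| by
    simp only [comp_val, addMap_val, mulMap_val, addObj_toR, mulObj_toR, typeIso_hom_val,
      typeHom_eq p, typeHom_eq q, typeHom_eq r, add_smul, smul_add, MulOpposite.op_add]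
    abel
  distribR_naturality p q r := typeHom_ext <| by
    simp only [comp_val, addMap_val, mulMap_val, addObj_toR, mulObj_toR, typeIso_hom_val,
      typeHom_eq p, typeHom_eq q, typeHom_eq r, add_smul, smul_add, MulOpposite.op_add]
    abel
  distribL_addAssoc x y z t := typeHom_ext <| by
    have h := f.lam_ξ x.toR y.toR z.toR t.toR
    simp only [comp_val, addMap_val, mulMap_val, addObj_toR, mulObj_toR, typeIso_hom_val,
      addAssoc_val, addComm_val, mulAssoc_val, id_val, smul_zero, add_zero, zero_add]
    linear_combination (norm := abel) -h
  distribL_addComm x y z := typeHom_ext <| by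
    have h := f.lam_η x.toR y.toR z.toR
    simp only [comp_val, addMap_val, mulMap_val, addObj_toR, mulObj_toR, typeIso_hom_val,
      addAssoc_val, addComm_val, mulAssoc_val, id_val, smul_zero, add_zero, zero_add]
    linear_combination (norm := abel) -h
  distribR_addAssoc x y z t := typeHom_ext <| by
    have h := f.rho_ξ x.toR y.toR z.toR t.toR
    simp only [comp_val, addMap_val, mulMap_val, addObj_toR, mulObj_toR, typeIso_hom_val,
      addAssoc_val, addComm_val, mulAssoc_val, id_val, smul_zero, add_zero, zero_add]
    linear_combination (norm := abel) -h
  distribR_addComm x y z := typeHom_ext <| by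
    have h := f.rho_η x.toR y.toR z.toR
    simp only [comp_val, addMap_val, mulMap_val, addObj_toR, mulObj_toR, typeIso_hom_val,
      addAssoc_val, addComm_val, mulAssoc_val, id_val, smul_zero, add_zero, zero_add]
    linear_combination (norm := abel) -h
  mulAssoc_distribL x y z t := typeHom_ext <| by
    have h := f.α_lam x.toR y.toR z.toR t.toR
    simp only [comp_val, addMap_val, mulMap_val, addObj_toR, mulObj_toR, typeIso_hom_val,
      addAssoc_val, addComm_val, mulAssoc_val, id_val, smul_zero, add_zero, zero_add]
    linear_combination (norm := abel) h
  mulAssoc_distribR x y z t := typeHom_ext <| by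
    have h := f.α_rho x.toR y.toR z.toR t.toR
    simp only [comp_val, addMap_val, mulMap_val, addObj_toR, mulObj_toR, typeIso_hom_val,
      addAssoc_val, addComm_val, mulAssoc_val, id_val, smul_zero, add_zero, zero_add]
    linear_combination (norm := abel) h
  mulAssoc_distribL_distribR x y z t := typeHom_ext <| by
    have h := f.α_lam_rho x.toR y.toR z.toR t.toR
    simp only [comp_val, addMap_val, mulMap_val, addObj_toR, mulObj_toR, typeIso_hom_val,
      addAssoc_val, addComm_val, mulAssoc_val, id_val, smul_zero, add_zero, zero_add]
    linear_combination (norm := abel) h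
  distribL_distribR x y z t := typeHom_ext <| by
    have h := f.lam_rho x.toR y.toR z.toR t.toR
    simp only [comp_val, addMap_val, typeIso_hom_val, interchange_val, addObj_toR, mulObj_toR]
    linear_combination (norm := abel) -h
  distribL_one x y := typeHom_ext <| by 
    simp only [comp_val, addMap_val, typeIso_hom_val, oneObj_toR, f.lam_one, oneMul_val, add_zero]
  distribR_one x y := typeHom_ext <| by 
    simp only [comp_val, addMap_val, typeIso_hom_val, oneObj_toR, f.rho_one, mulOne_val, add_zero]

end TypeCategory

end Ann

/-! The category of type `(Π₀, Π₁)` is reached from `A` directly: the equivalence sends `X` to its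
class `cl X` and a morphism `f` to a coordinate `val f` in `Π₁`, so no structure has to be
transported to a skeleton of `A`.

The coordinate exists because objects are invertible for `⊕`. Adding `X` identifies `Aut 0` with the
endomorphisms of `X` (`act`, bijective by `act_injective` and `act_surjective`), naturally in `X`.
Under this identification `⊕` becomes addition and `⊗` becomes the formula with the two actions
(`endVal_addMap`, `endVal_mulMap`). A coherent choice of a morphism between any two isomorphic
objects then turns every morphism into an endomorphism. The resulting `val` is additive on
composites and bijective on each nonempty hom-set.

The functor respects `⊕` and `⊗` only up to a `Correction`, an element of `Π₁` for each pair of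
objects. Correcting the coordinates of `a⁺`, `c`, `a`, `𝔏`, `ℜ` accordingly gives cochains on
objects. Naturality of the constraints makes them functions of classes, and each relation for `ξ, η,
α, λ, ρ` is the coordinate of a coherence diagram of `A`. By construction the corrections are the
structure isomorphisms of an Ann-functor.

What remains is normalisation. A correction may be changed by any functions of pairs of classes. One
change makes it agree with the unit constraints (`exists_isUnital`); a second, of the multiplicative
part only, kills `ρ(0,0,z)` and `λ(x,0,0)` (`exists_isNormal`). All other vanishing conditions at
`0` then follow by putting zeros into the relations. -/

namespace Ann

/-! ### Endomorphisms of an object as elements of `Π₁`. -/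

section EndVal

variable {A : Type u} [Category.{v} A] [AnnCategory A]

theorem addAssoc_naturality {X X' Y Y' Z Z' : A} (p : X ⟶ X') (q : Y ⟶ Y') (r : Z ⟶ Z') :
    (p ⊕ₕ (q ⊕ₕ r)) ≫ (addAssoc X' Y' Z').hom = (addAssoc X Y Z).hom ≫ ((p ⊕ₕ q) ⊕ₕ r) := by
  let _ := BimonoidalData.addMonoidal (A := A)
  exact MonoidalCategory.associator_inv_naturality p q r

theorem zeroAdd_naturality {X Y : A} (p : X ⟶ Y) :
    (𝟙 (zeroObj A) ⊕ₕ p) ≫ (zeroAdd Y).hom = (zeroAdd X).hom ≫ p := by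
  let _ := BimonoidalData.addMonoidal (A := A)
  have h := MonoidalCategory.leftUnitor_naturality p
  rwa [← MonoidalCategory.id_tensorHom] at h

theorem addZero_naturality {X Y : A} (p : X ⟶ Y) :
    (p ⊕ₕ 𝟙 (zeroObj A)) ≫ (addZero Y).hom = (addZero X).hom ≫ p := by
  let _ := BimonoidalData.addMonoidal (A := A)
  have h := MonoidalCategory.rightUnitor_naturality p
  rwa [← MonoidalCategory.tensorHom_id] at h

theorem addComm_naturality {X X' Y Y' : A} (p : X ⟶ X') (q : Y ⟶ Y') :
    (p ⊕ₕ q) ≫ (addComm X' Y').hom = (addComm X Y).hom ≫ (q ⊕ₕ p) := by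
  let _ := BimonoidalData.addMonoidal (A := A)
  let _ := BimonoidalData.addSymmetric (A := A)
  exact BraidedCategory.braiding_naturality p q

theorem addAssoc_zeroAdd (X Y : A) :
    (addAssoc (zeroObj A) X Y).hom ≫ ((zeroAdd X).hom ⊕ₕ 𝟙 Y) = (zeroAdd (X ⊕ₒ Y)).hom := by
  let _ := BimonoidalData.addMonoidal (A := A)
  have h := MonoidalCategory.leftUnitor_tensor_hom X Y
  rw [h, ← MonoidalCategory.tensorHom_id]
  rfl

/-- an endomorphism of `0` as an element of `Π₁` -/
noncomputable def Pi1.ofEnd (w : zeroObj A ⟶ zeroObj A) : Pi1 A :=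
  letI := AnnCategory.isIso_hom w
  Pi1.ofAut (asIso w)

/-- If `W` is inverse to `Z`, then adding `W` undoes adding `Z`: every morphism is recovered from
its image by conjugating with `a⁺`, `Z ⊕ W ≅ 0` and `d`. -/
theorem addMap_id_faithful {X Y : A} (Z : A) {p q : X ⟶ Y} (h : (p ⊕ₕ 𝟙 Z) = (q ⊕ₕ 𝟙 Z)) :
    p = q := by
  obtain ⟨W, ⟨e⟩⟩ := AnnCategory.exists_neg Z
  have key : ∀ r : X ⟶ Y, r = (addZero X).inv ≫ (𝟙 X ⊕ₕ e.inv) ≫ (addAssoc X Z W).hom ≫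
      ((r ⊕ₕ 𝟙 Z) ⊕ₕ 𝟙 W) ≫ (addAssoc Y Z W).inv ≫ (𝟙 Y ⊕ₕ e.hom) ≫ (addZero Y).hom := by
    intro r
    rw [Iso.eq_inv_comp, ← addZero_naturality, ← Category.assoc (addAssoc X Z W).hom,
      ← addAssoc_naturality, Category.assoc, Iso.hom_inv_id_assoc, ← Category.assoc (_ ⊕ₕ _),
      addMap_comp, ← Category.assoc, addMap_comp, addMap_id]
    simp
  rw [key p, key q, h]

/-- The endomorphism of `X` that corresponds to `u : Aut 0`. -/
def act (X : A) (w : zeroObj A ⟶ zeroObj A) : X ⟶ X :=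
  (zeroAdd X).inv ≫ (w ⊕ₕ 𝟙 X) ≫ (zeroAdd X).hom

theorem zeroAdd_act (X : A) (w : zeroObj A ⟶ zeroObj A) :
    (zeroAdd X).hom ≫ act X w = (w ⊕ₕ 𝟙 X) ≫ (zeroAdd X).hom :=
  Iso.hom_inv_id_assoc _ _

theorem act_comp (X : A) (w w' : zeroObj A ⟶ zeroObj A) :
    act X (w ≫ w') = act X w ≫ act X w' := by
  rw [← cancel_epi (zeroAdd X).hom, zeroAdd_act, ← Category.assoc, zeroAdd_act, Category.assoc,
    zeroAdd_act, ← Category.assoc, addMap_comp, Category.id_comp]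

theorem act_injective (X : A) {w w' : zeroObj A ⟶ zeroObj A} (h : act X w = act X w') :
    w = w' := by
  rw [← cancel_epi (zeroAdd X).hom, zeroAdd_act, zeroAdd_act, cancel_mono] at h
  exact addMap_id_faithful X h

/-- For fixed `w` the maps `act X w` form an endomorphism of the identity functor. Hence the
coordinate of an endomorphism is unchanged by conjugation, and choices of isomorphisms drop out. -/
theorem act_naturality {X Y : A} (f : X ⟶ Y) (w : zeroObj A ⟶ zeroObj A) :
    act X w ≫ f = f ≫ act Y w := by
  rw [← cancel_epi (zeroAdd X).hom, ← Category.assoc, zeroAdd_act, Category.assoc,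
    ← zeroAdd_naturality, ← Category.assoc, addMap_comp, ← Category.assoc, ← zeroAdd_naturality,
    Category.assoc, zeroAdd_act, ← Category.assoc, addMap_comp]
  simp

theorem act_addMap_id (X Y : A) (w : zeroObj A ⟶ zeroObj A) :
    (act X w ⊕ₕ 𝟙 Y) = act (X ⊕ₒ Y) w := by
  have := AnnCategory.isIso_hom ((zeroAdd X).hom ⊕ₕ 𝟙 Y)
  rw [← cancel_epi ((zeroAdd X).hom ⊕ₕ 𝟙 Y), addMap_comp, zeroAdd_act,
    ← cancel_epi (addAssoc (zeroObj A) X Y).hom, ← Category.assoc _ _ (act _ _),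
    addAssoc_zeroAdd, zeroAdd_act, ← addAssoc_zeroAdd, ← addMap_id, ← Category.assoc,
    addAssoc_naturality, Category.assoc, addMap_comp]

theorem id_addMap_act (X Y : A) (w : zeroObj A ⟶ zeroObj A) :
    (𝟙 X ⊕ₕ act Y w) = act (X ⊕ₒ Y) w := by
  rw [← cancel_mono (addComm X Y).hom, addComm_naturality, act_addMap_id, act_naturality]

theorem act_zeroObj (w : zeroObj A ⟶ zeroObj A) : act (zeroObj A) w = w := by
  rw [← cancel_epi (zeroAdd (zeroObj A)).hom, zeroAdd_act, addMap_zero, Category.comp_id]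

/-- Adding an inverse `Y` of `X` turns `f` into an endomorphism of `X ⊕ Y ≅ 0`, that is, into the
required `w`. Faithfulness of `- ⊕ Y` brings the equation back to `X`. -/
theorem act_surjective (X : A) (f : X ⟶ X) : ∃ w, act X w = f := by
  obtain ⟨Y, ⟨e⟩⟩ := AnnCategory.exists_neg X
  let w := e.inv ≫ (f ⊕ₕ 𝟙 Y) ≫ e.hom
  refine ⟨w, addMap_id_faithful Y ?_⟩
  rw [act_addMap_id, ← cancel_mono e.hom, act_naturality, act_zeroObj]
  exact Iso.hom_inv_id_assoc _ _

/-- The left action is defined on `X ⊗ 0`. Writing `Y` as `0 ⊕ Y` and distributing carries it over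
to `X ⊗ Y`: the summand `X ⊗ 0` contributes the action of `cl X`, the summand `X ⊗ Y` the identity.
-/
theorem id_mulMap_act (X Y : A) (u : Pi1 A) :
    (𝟙 X ⊗ₕ act Y u.toAut.hom) = act (X ⊗ₒ Y) (cl X • u).toAut.hom := by
  obtain ⟨e⟩ := nonempty_mulZero X
  have h1 : (𝟙 X ⊗ₕ u.toAut.hom) = act _ (cl X • u).toAut.hom := by
    rw [← cancel_mono e.hom, lamAct_spec, act_naturality, act_zeroObj]
    rfl
  have := AnnCategory.isIso_hom (𝟙 X ⊗ₕ (zeroAdd Y).hom)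
  rw [← cancel_epi (𝟙 X ⊗ₕ (zeroAdd Y).hom), mulMap_comp, zeroAdd_act, ← act_naturality,
    ← mulMap_comp]
  congr 1
  rw [← cancel_mono (AnnCategory.distribL X _ Y).hom, AnnCategory.distribL_naturality, h1,
    mulMap_id, act_addMap_id, act_naturality]

theorem mulMap_act_id (X Y : A) (u : Pi1 A) :
    (act X u.toAut.hom ⊗ₕ 𝟙 Y) = act (X ⊗ₒ Y) (u <• cl Y).toAut.hom := by
  obtain ⟨e⟩ := nonempty_zeroMul Y
  have h1 : (u.toAut.hom ⊗ₕ 𝟙 Y) = act _ (u <• cl Y).toAut.hom := by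
    rw [← cancel_mono e.hom, rhoAct_spec, act_naturality, act_zeroObj]
    rfl
  have := AnnCategory.isIso_hom ((zeroAdd X).hom ⊗ₕ 𝟙 Y)
  rw [← cancel_epi ((zeroAdd X).hom ⊗ₕ 𝟙 Y), mulMap_comp, zeroAdd_act, ← act_naturality,
    ← mulMap_comp]
  congr 1
  rw [← cancel_mono (AnnCategory.distribR _ X Y).hom, AnnCategory.distribR_naturality, h1,
    mulMap_id, act_addMap_id, act_naturality]

/-- The element of `Π₁` that acts on `X` as `f`. -/
noncomputable def endVal {X : A} (f : X ⟶ X) : Pi1 A :=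
  Pi1.ofEnd (act_surjective X f).choose

theorem act_endVal {X : A} (f : X ⟶ X) : act X (endVal f).toAut.hom = f :=
  (act_surjective X f).choose_spec

theorem endVal_act (X : A) (u : Pi1 A) : endVal (act X u.toAut.hom) = u :=
  Pi1.ext (act_injective X (act_endVal _))

theorem endVal_comp {X : A} (f g : X ⟶ X) : endVal (f ≫ g) = endVal f + endVal g := by
  conv_lhs => rw [← act_endVal f, ← act_endVal g, ← act_comp, ← Pi1.add_hom, endVal_act]

theorem endVal_conj {X Y : A} {f : X ⟶ X} {g : Y ⟶ Y} (h : X ⟶ Y) (w : f ≫ h = h ≫ g) :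
    endVal f = endVal g := by
  have := AnnCategory.isIso_hom h
  have e : act Y (endVal f).toAut.hom = g := by
    rw [← cancel_epi h, ← act_naturality, act_endVal, w]
  rw [← e, endVal_act]

theorem endVal_addMap {X Y : A} (f : X ⟶ X) (g : Y ⟶ Y) :
    endVal (f ⊕ₕ g) = endVal f + endVal g := by
  have h : (f ⊕ₕ g) = (f ⊕ₕ 𝟙 Y) ≫ (𝟙 X ⊕ₕ g) := by
    rw [addMap_comp, Category.id_comp, Category.comp_id]
  conv_lhs => rw [h, ← act_endVal f, ← act_endVal g, act_addMap_id, id_addMap_act, endVal_comp,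
    endVal_act, endVal_act]

/-- Bifunctoriality splits `f ⊗ g` into one factor for each action. The result is exactly the tensor
product of morphisms in a category of type `(R, M)`. -/
theorem endVal_mulMap {X Y : A} (f : X ⟶ X) (g : Y ⟶ Y) :
    endVal (f ⊗ₕ g) = cl X • endVal g + endVal f <• cl Y := by
  have h : (f ⊗ₕ g) = (𝟙 X ⊗ₕ g) ≫ (f ⊗ₕ 𝟙 Y) := by
    rw [mulMap_comp, Category.id_comp, Category.comp_id]
  conv_lhs => rw [h, ← act_endVal f, ← act_endVal g, id_mulMap_act, mulMap_act_id, endVal_comp,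
    endVal_act, endVal_act]

/-! ### Coordinates of arbitrary morphisms. -/

theorem cl_eq_of_hom {X Y : A} (f : X ⟶ Y) : cl X = cl Y :=
  letI := AnnCategory.isIso_hom f
  cl_eq (asIso f)

/-- the chosen object in an isomorphism class -/
noncomputable def rep (s : Pi0 A) : A := Quotient.out s

omit [AnnCategory A] in
theorem cl_rep (s : Pi0 A) : cl (rep s) = s := Quotient.out_eq s

/-- the chosen isomorphism of an object with the representative of its class -/
noncomputable def toRep (X : A) : X ≅ rep (cl X) := (cl_exact (cl_rep (cl X)).symm).some

/-- the chosen morphism between two objects of the same class -/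
noncomputable def bridge {X Y : A} (h : cl X = cl Y) : X ⟶ Y :=
  (toRep X).hom ≫ eqToHom (congrArg rep h) ≫ (toRep Y).inv

omit [AnnCategory A] in
-- All chosen morphisms pass through the representative of the class, so they form a coherent
-- system. This is what makes `val` additive on composites.
theorem bridge_comp {X Y Z : A} (h : cl X = cl Y) (h' : cl Y = cl Z) :
    bridge h ≫ bridge h' = bridge (h.trans h') := by
  simp [bridge]

omit [AnnCategory A] in
theorem bridge_self (X : A) : bridge (rfl : cl X = cl X) = 𝟙 X := by
  simp [bridge]

/-- The coordinate in `Π₁` of a morphism, relative to the chosen morphisms. -/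
noncomputable def val {X Y : A} (f : X ⟶ Y) : Pi1 A :=
  endVal (f ≫ bridge (cl_eq_of_hom f).symm)

theorem val_end {X : A} (f : X ⟶ X) : val f = endVal f := by
  rw [val, bridge_self, Category.comp_id]

theorem val_comp {X Y Z : A} (f : X ⟶ Y) (g : Y ⟶ Z) : val (f ≫ g) = val f + val g := by
  -- Inserting the chosen morphisms `Y ⟶ X ⟶ Y` between `f` and `g` gives the endomorphism of `f`
  -- followed by a conjugate of the endomorphism of `g`.
  have h : (f ≫ g) ≫ bridge (cl_eq_of_hom (f ≫ g)).symm =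
      (f ≫ bridge (cl_eq_of_hom f).symm) ≫
        (bridge (cl_eq_of_hom f) ≫ (g ≫ bridge (cl_eq_of_hom g).symm) ≫
          bridge (cl_eq_of_hom f).symm) := by
    have h1 := bridge_comp (cl_eq_of_hom g).symm (cl_eq_of_hom f).symm
    have h2 := bridge_comp (cl_eq_of_hom f).symm (cl_eq_of_hom f)
    rw [bridge_self] at h2
    simp only [Category.assoc, h1, reassoc_of% h2]
  rw [val, h, endVal_comp, val, val]
  congr 1
  refine endVal_conj (bridge (cl_eq_of_hom f)) ?_
  have h3 := bridge_comp (cl_eq_of_hom f).symm (cl_eq_of_hom f)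
  rw [bridge_self] at h3
  simp only [Category.assoc, h3, Category.comp_id]

theorem val_id (X : A) : val (𝟙 X) = 0 := by
  have h := val_comp (𝟙 X) (𝟙 X)
  rw [Category.comp_id] at h
  exact left_eq_add.1 h

theorem val_inv {X Y : A} (e : X ≅ Y) : val e.inv = -val e.hom := by
  rw [eq_neg_iff_add_eq_zero, ← val_comp, Iso.inv_hom_id, val_id]

theorem val_bridge {X Y : A} (h : cl X = cl Y) : val (bridge h) = 0 := by
  rw [val, bridge_comp, bridge_self, ← val_end, val_id]

theorem val_injective {X Y : A} {f g : X ⟶ Y} (h : val f = val g) : f = g := by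
  have := AnnCategory.isIso_hom (bridge (cl_eq_of_hom f).symm)
  rw [← cancel_mono (bridge (cl_eq_of_hom f).symm), ← act_endVal (f ≫ _), ← act_endVal (g ≫ _)]
  -- `f` and `g` are compared through the same chosen morphism, since it depends only on the
  -- endpoints and not on the proof that their classes agree.
  exact congrArg (fun u : Pi1 A => act X u.toAut.hom) h

theorem val_surjective {X Y : A} (h : cl X = cl Y) (u : Pi1 A) : ∃ f : X ⟶ Y, val f = u :=
  ⟨act X u.toAut.hom ≫ bridge h, by
    rw [val_comp, val_bridge, val_end, endVal_act, add_zero]⟩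

end EndVal

/-! ### Corrections and their existence. -/

section Corrections

variable {A : Type u} [Category.{v} A] [AnnCategory A]

variable (A) in
/-- The coordinates of the structure isomorphisms that make `X ↦ cl X`, `f ↦ val f` compatible
with `⊕` and `⊗`. -/
structure Correction where
  add : A → A → Pi1 A
  mul : A → A → Pi1 A
  add_naturality : ∀ {X X' Y Y' : A} (f : X ⟶ X') (g : Y ⟶ Y'),
    val (f ⊕ₕ g) + add X' Y' = add X Y + (val f + val g)
  mul_naturality : ∀ {X X' Y Y' : A} (f : X ⟶ X') (g : Y ⟶ Y'),
    val (f ⊗ₕ g) + mul X' Y' = mul X Y + (cl X • val g + val f <• cl Y)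

/-- the chosen morphism to the representative -/
noncomputable def bridgeRep (X : A) {s : Pi0 A} (h : cl X = s) : X ⟶ rep s :=
  bridge (h.trans (cl_rep s).symm)

theorem val_eq_endVal_of_comp {X X' Z : A} (f : X ⟶ X') (p : X ⟶ Z) (p' : X' ⟶ Z) (k : Z ⟶ Z)
    (hp : val p = 0) (hp' : val p' = 0) (h : f ≫ p' = p ≫ k) : val f = endVal k := by
  have h1 := congrArg val h
  rwa [val_comp, val_comp, hp, hp', add_zero, zero_add, val_end] at h1

/-- Moves `f` to an endomorphism of a representative, where `endVal` applies. The class `s` is a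
variable so that `X` and `X'` are sent to literally the same object, although `cl X` and `cl X'` are
only propositionally equal. -/
theorem exists_comp_bridgeRep {X X' : A} (f : X ⟶ X') {s : Pi0 A} (h : cl X = s)
    (h' : cl X' = s) :
    ∃ k : rep s ⟶ rep s, f ≫ bridgeRep X' h' = bridgeRep X h ≫ k ∧ val f = endVal k := by
  have := AnnCategory.isIso_hom (bridgeRep X h)
  have e : f ≫ bridgeRep X' h' =
      bridgeRep X h ≫ (inv (bridgeRep X h) ≫ f ≫ bridgeRep X' h') := by simp
  exact ⟨_, e, val_eq_endVal_of_comp f _ _ _ (val_bridge _) (val_bridge _) e⟩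

theorem exists_correction : Nonempty (Correction A) := by
  refine ⟨
    -- The morphisms to the representatives have coordinate zero, but their sums and products need
    -- not; that defect is the correction.
    { add := fun X Y => val (bridgeRep X rfl ⊕ₕ bridgeRep Y rfl)
      mul := fun X Y => val (bridgeRep X rfl ⊗ₕ bridgeRep Y rfl)
      add_naturality := fun {X X' Y Y'} f g => ?_
      mul_naturality := fun {X X' Y Y'} f g => ?_ }⟩
  · have key : ∀ s t (h : cl X = s) (h1 : cl X' = s) (h' : cl Y = t) (h1' : cl Y' = t),
        val (f ⊕ₕ g) + val (bridgeRep X' h1 ⊕ₕ bridgeRep Y' h1') =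
          val (bridgeRep X h ⊕ₕ bridgeRep Y h') + (val f + val g) := by
      intro s t h h1 h' h1'
      obtain ⟨k, hk, ek⟩ := exists_comp_bridgeRep f h h1
      obtain ⟨l, hl, el⟩ := exists_comp_bridgeRep g h' h1'
      rw [← val_comp, addMap_comp, hk, hl, ← addMap_comp, val_comp, val_end (k ⊕ₕ l),
        endVal_addMap, ek, el]
    -- The correction at `X', Y'` refers to the representatives of `cl X', cl Y'`, while `key` needs
    -- a single pair of representatives for source and target; the two agree after substituting the
    -- equations of classes.
    have h2 : ∀ s t (h1 : cl X' = s) (h1' : cl Y' = t),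
        val (bridgeRep X' (rfl : cl X' = cl X') ⊕ₕ bridgeRep Y' (rfl : cl Y' = cl Y')) =
          val (bridgeRep X' h1 ⊕ₕ bridgeRep Y' h1') := by
      intro s t h1 h1'
      subst h1 h1'
      rfl
    rw [h2 _ _ (cl_eq_of_hom f).symm (cl_eq_of_hom g).symm]
    exact key _ _ _ _ _ _
  · have key : ∀ s t (h : cl X = s) (h1 : cl X' = s) (h' : cl Y = t) (h1' : cl Y' = t),
        val (f ⊗ₕ g) + val (bridgeRep X' h1 ⊗ₕ bridgeRep Y' h1') =
          val (bridgeRep X h ⊗ₕ bridgeRep Y h') + (cl X • val g + val f <• cl Y) := by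
      intro s t h h1 h' h1'
      obtain ⟨k, hk, ek⟩ := exists_comp_bridgeRep f h h1
      obtain ⟨l, hl, el⟩ := exists_comp_bridgeRep g h' h1'
      rw [← val_comp, mulMap_comp, hk, hl, ← mulMap_comp, val_comp, val_end (k ⊗ₕ l),
        endVal_mulMap, ek, el, cl_rep, cl_rep, h, h']
    have h2 : ∀ s t (h1 : cl X' = s) (h1' : cl Y' = t),
        val (bridgeRep X' (rfl : cl X' = cl X') ⊗ₕ bridgeRep Y' (rfl : cl Y' = cl Y')) =
          val (bridgeRep X' h1 ⊗ₕ bridgeRep Y' h1') := by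
      intro s t h1 h1'
      subst h1 h1'
      rfl
    rw [h2 _ _ (cl_eq_of_hom f).symm (cl_eq_of_hom g).symm]
    exact key _ _ _ _ _ _

/-! ### Coherence diagrams of the two monoidal structures, with whiskerings written as sums and
products with identities. -/

theorem add_pentagon (X Y Z T : A) :
    (𝟙 X ⊕ₕ (addAssoc Y Z T).hom) ≫ (addAssoc X (Y ⊕ₒ Z) T).hom ≫
        ((addAssoc X Y Z).hom ⊕ₕ 𝟙 T) =
      (addAssoc X Y (Z ⊕ₒ T)).hom ≫ (addAssoc (X ⊕ₒ Y) Z T).hom := by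
  let _ := BimonoidalData.addMonoidal (A := A)
  have h := MonoidalCategory.pentagon_inv (W := X) (X := Y) (Y := Z) (Z := T)
  rwa [← MonoidalCategory.id_tensorHom, ← MonoidalCategory.tensorHom_id] at h

theorem mul_pentagon (X Y Z T : A) :
    (𝟙 X ⊗ₕ (mulAssoc Y Z T).hom) ≫ (mulAssoc X (Y ⊗ₒ Z) T).hom ≫
        ((mulAssoc X Y Z).hom ⊗ₕ 𝟙 T) =
      (mulAssoc X Y (Z ⊗ₒ T)).hom ≫ (mulAssoc (X ⊗ₒ Y) Z T).hom := by
  let _ := BimonoidalData.mulMonoidal (A := A)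
  have h := MonoidalCategory.pentagon_inv (W := X) (X := Y) (Y := Z) (Z := T)
  rwa [← MonoidalCategory.id_tensorHom, ← MonoidalCategory.tensorHom_id] at h

theorem add_hexagon (X Y Z : A) :
    (addAssoc X Y Z).hom ≫ (addComm (X ⊕ₒ Y) Z).hom ≫ (addAssoc Z X Y).hom =
      (𝟙 X ⊕ₕ (addComm Y Z).hom) ≫ (addAssoc X Z Y).hom ≫ ((addComm X Z).hom ⊕ₕ 𝟙 Y) := by
  let _ := BimonoidalData.addMonoidal (A := A)
  let _ := BimonoidalData.addSymmetric (A := A)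
  have h := BraidedCategory.hexagon_reverse X Y Z
  rwa [← MonoidalCategory.id_tensorHom, ← MonoidalCategory.tensorHom_id] at h

theorem addComm_symm (X Y : A) : (addComm X Y).hom ≫ (addComm Y X).hom = 𝟙 (X ⊕ₒ Y) := by
  let _ := BimonoidalData.addMonoidal (A := A)
  let _ := BimonoidalData.addSymmetric (A := A)
  exact SymmetricCategory.symmetry X Y

theorem add_triangle (X Y : A) :
    (addAssoc X (zeroObj A) Y).hom ≫ ((addZero X).hom ⊕ₕ 𝟙 Y) = (𝟙 X ⊕ₕ (zeroAdd Y).hom) := by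
  let _ := BimonoidalData.addMonoidal (A := A)
  have h := MonoidalCategory.triangle_assoc_comp_right X Y
  rwa [← MonoidalCategory.id_tensorHom, ← MonoidalCategory.tensorHom_id] at h

theorem mul_triangle (X Y : A) :
    (mulAssoc X (oneObj A) Y).hom ≫ ((mulOne X).hom ⊗ₕ 𝟙 Y) = (𝟙 X ⊗ₕ (oneMul Y).hom) := by
  let _ := BimonoidalData.mulMonoidal (A := A)
  have h := MonoidalCategory.triangle_assoc_comp_right X Y
  rwa [← MonoidalCategory.id_tensorHom, ← MonoidalCategory.tensorHom_id] at h

theorem mulAssoc_oneMul (X Y : A) :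
    (mulAssoc (oneObj A) X Y).hom ≫ ((oneMul X).hom ⊗ₕ 𝟙 Y) = (oneMul (X ⊗ₒ Y)).hom := by
  let _ := BimonoidalData.mulMonoidal (A := A)
  have h := MonoidalCategory.leftUnitor_tensor_hom X Y
  rw [h, ← MonoidalCategory.tensorHom_id]
  rfl

theorem mulAssoc_mulOne (X Y : A) :
    (mulAssoc X Y (oneObj A)).hom ≫ (mulOne (X ⊗ₒ Y)).hom = (𝟙 X ⊗ₕ (mulOne Y).hom) := by
  let _ := BimonoidalData.mulMonoidal (A := A)
  have h := MonoidalCategory.rightUnitor_tensor_hom X Y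
  rw [h, ← MonoidalCategory.id_tensorHom]
  exact Iso.inv_hom_id_assoc _ _

theorem interchange_eq (X Y Z T : A) :
    interchange X Y Z T = (addAssoc X Y (Z ⊕ₒ T)).inv ≫
      (𝟙 X ⊕ₕ (addAssoc Y Z T).hom) ≫ (𝟙 X ⊕ₕ ((addComm Y Z).hom ⊕ₕ 𝟙 T)) ≫
        (𝟙 X ⊕ₕ (addAssoc Z Y T).inv) ≫ (addAssoc X Z (Y ⊕ₒ T)).hom := by
  let _ := BimonoidalData.addMonoidal (A := A)
  let _ := BimonoidalData.addSymmetric (A := A)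
  change MonoidalCategory.tensorμ X Y Z T = _
  simp only [MonoidalCategory.tensorμ, ← MonoidalCategory.id_tensorHom,
    ← MonoidalCategory.tensorHom_id]
  rfl

theorem oneMul_oneObj : oneMul (oneObj A) = mulOne (oneObj A) := by
  let _ := BimonoidalData.mulMonoidal (A := A)
  exact Iso.ext MonoidalCategory.unitors_equal

theorem zeroAdd_zeroObj : zeroAdd (zeroObj A) = addZero (zeroObj A) := by
  let _ := BimonoidalData.addMonoidal (A := A)
  exact Iso.ext MonoidalCategory.unitors_equal

/-- the function on classes given by an isomorphism-invariant function on triples of objects -/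
noncomputable def descend {M : Type*} (G : A → A → A → M) (x y z : Pi0 A) : M :=
  G (rep x) (rep y) (rep z)

omit [AnnCategory A] in
-- A naturality square is what supplies `h`; it is applied to the morphisms from the given objects
-- to their representatives.
theorem descend_cl {M : Type*} {G : A → A → A → M}
    (h : ∀ {X X' Y Y' Z Z' : A}, (X ⟶ X') → (Y ⟶ Y') → (Z ⟶ Z') → G X Y Z = G X' Y' Z')
    (X Y Z : A) : descend G (cl X) (cl Y) (cl Z) = G X Y Z :=
  (h (bridgeRep X rfl) (bridgeRep Y rfl) (bridgeRep Z rfl)).symm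

/-! ### The corrected coordinates of the constraints as functions of classes. -/

namespace Correction

variable (c : Correction A)

theorem val_addMap {X X' Y Y' : A} (f : X ⟶ X') (g : Y ⟶ Y') :
    val (f ⊕ₕ g) = c.add X Y + (val f + val g) - c.add X' Y' :=
  eq_sub_of_add_eq (c.add_naturality f g)

theorem val_mulMap {X X' Y Y' : A} (f : X ⟶ X') (g : Y ⟶ Y') :
    val (f ⊗ₕ g) = c.mul X Y + (cl X • val g + val f <• cl Y) - c.mul X' Y' :=
  eq_sub_of_add_eq (c.mul_naturality f g)

/-- the additive associativity cochain on objects -/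
noncomputable def xiObj (X Y Z : A) : Pi1 A :=
  val (addAssoc X Y Z).hom + c.add (X ⊕ₒ Y) Z + c.add X Y - c.add X (Y ⊕ₒ Z) - c.add Y Z

/-- the commutativity cochain on objects -/
noncomputable def etaObj (X Y : A) : Pi1 A :=
  val (addComm X Y).hom + c.add Y X - c.add X Y

/-- the multiplicative associativity cochain on objects -/
noncomputable def alObj (X Y Z : A) : Pi1 A :=
  val (mulAssoc X Y Z).hom + c.mul (X ⊗ₒ Y) Z + c.mul X Y <• cl Z - c.mul X (Y ⊗ₒ Z)
    - cl X • c.mul Y Z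

/-- the left distributivity cochain on objects -/
noncomputable def lamObj (X Y Z : A) : Pi1 A :=
  val (AnnCategory.distribL X Y Z).hom + c.add (X ⊗ₒ Y) (X ⊗ₒ Z) + c.mul X Y + c.mul X Z
    - c.mul X (Y ⊕ₒ Z) - cl X • c.add Y Z

/-- the right distributivity cochain on objects -/
noncomputable def rhoObj (X Y Z : A) : Pi1 A :=
  val (AnnCategory.distribR X Y Z).hom + c.add (X ⊗ₒ Z) (Y ⊗ₒ Z) + c.mul X Z + c.mul Y Z
    - c.mul (X ⊕ₒ Y) Z - c.add X Y <• cl Z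

noncomputable def xi : Pi0 A → Pi0 A → Pi0 A → Pi1 A := descend c.xiObj
-- The third slot is a dummy, so that the construction for triples serves for pairs.
noncomputable def eta (x y : Pi0 A) : Pi1 A := descend (fun X Y _ => c.etaObj X Y) x y 0
noncomputable def al : Pi0 A → Pi0 A → Pi0 A → Pi1 A := descend c.alObj
noncomputable def lam : Pi0 A → Pi0 A → Pi0 A → Pi1 A := descend c.lamObj
noncomputable def rho : Pi0 A → Pi0 A → Pi0 A → Pi1 A := descend c.rhoObj

/-- In the coordinates of the naturality square of `a⁺`, those of the three morphisms occur on both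
sides and cancel; what is left is the invariance of `xiObj`. The same argument works for the other
four cochains. -/
theorem xi_cl (X Y Z : A) : c.xi (cl X) (cl Y) (cl Z) = c.xiObj X Y Z := by
  refine descend_cl (fun {X X' Y Y' Z Z'} f g k => ?_) X Y Z
  have h := congrArg val (addAssoc_naturality f g k)
  simp only [val_comp, c.val_addMap] at h
  simp only [xiObj]
  linear_combination (norm := abel) -h

theorem eta_cl (X Y : A) : c.eta (cl X) (cl Y) = c.etaObj X Y := by
  refine descend_cl (G := fun X Y _ => c.etaObj X Y)
    (fun {X X' Y Y' Z Z'} f g k => ?_) X Y (zeroObj A)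
  have h := congrArg val (addComm_naturality f g)
  simp only [val_comp, c.val_addMap] at h
  simp only [etaObj]
  linear_combination (norm := abel) -h

theorem al_cl (X Y Z : A) : c.al (cl X) (cl Y) (cl Z) = c.alObj X Y Z := by
  refine descend_cl (fun {X X' Y Y' Z Z'} f g k => ?_) X Y Z
  have h := congrArg val (mulAssoc_naturality f g k)
  simp only [val_comp, c.val_mulMap, cl_mul, MulOpposite.op_mul, mul_smul, smul_add, smul_sub,
    cl_eq_of_hom f, cl_eq_of_hom g, cl_eq_of_hom k,
    smul_comm (cl X') (MulOpposite.op (cl Z'))] at h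
  simp only [alObj, cl_eq_of_hom f, cl_eq_of_hom k]
  linear_combination (norm := abel) -h

theorem lam_cl (X Y Z : A) : c.lam (cl X) (cl Y) (cl Z) = c.lamObj X Y Z := by
  refine descend_cl (fun {X X' Y Y' Z Z'} f g k => ?_) X Y Z
  have h := congrArg val (AnnCategory.distribL_naturality f g k)
  simp only [val_comp, c.val_mulMap, c.val_addMap, cl_add, MulOpposite.op_add, add_smul, smul_add,
    smul_sub, cl_eq_of_hom f, cl_eq_of_hom g, cl_eq_of_hom k] at h
  simp only [lamObj, cl_eq_of_hom f]
  linear_combination (norm := abel) -h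

theorem rho_cl (X Y Z : A) : c.rho (cl X) (cl Y) (cl Z) = c.rhoObj X Y Z := by
  refine descend_cl (fun {X X' Y Y' Z Z'} f g k => ?_) X Y Z
  have h := congrArg val (AnnCategory.distribR_naturality f g k)
  simp only [val_comp, c.val_mulMap, c.val_addMap, cl_add, MulOpposite.op_add, add_smul, smul_add,
    smul_sub, cl_eq_of_hom f, cl_eq_of_hom g, cl_eq_of_hom k] at h
  simp only [rhoObj, cl_eq_of_hom k]
  linear_combination (norm := abel) -h

/-! ### The cochain relations, each the coordinate of one coherence diagram, in which the
corrections cancel. -/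

theorem xi_pentagon (x y z t : Pi0 A) :
    c.xi y z t - c.xi (x + y) z t + c.xi x (y + z) t - c.xi x y (z + t) + c.xi x y z = 0 := by
  induction x using Pi0.ind with | _ X
  induction y using Pi0.ind with | _ Y
  induction z using Pi0.ind with | _ Z
  induction t using Pi0.ind with | _ T
  have h := congrArg val (add_pentagon X Y Z T)
  simp only [val_comp, c.val_addMap, val_id] at h
  simp only [← cl_add, xi_cl, xiObj]
  linear_combination (norm := abel) h

theorem xi_eta_hexagon (x y z : Pi0 A) :
    c.xi x y z - c.xi x z y + c.xi z x y - c.eta x z + c.eta (x + y) z - c.eta y z = 0 := by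
  induction x using Pi0.ind with | _ X
  induction y using Pi0.ind with | _ Y
  induction z using Pi0.ind with | _ Z
  have h := congrArg val (add_hexagon X Y Z)
  simp only [val_comp, c.val_addMap, val_id] at h
  simp only [← cl_add, xi_cl, xiObj, eta_cl, etaObj]
  linear_combination (norm := abel) h

theorem eta_symm (x y : Pi0 A) : c.eta x y + c.eta y x = 0 := by
  induction x using Pi0.ind with | _ X
  induction y using Pi0.ind with | _ Y
  have h := congrArg val (addComm_symm X Y)
  simp only [val_comp, val_id] at h
  simp only [eta_cl, etaObj]
  linear_combination (norm := abel) h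

theorem lam_eta (x y z : Pi0 A) :
    x • c.eta y z - c.eta (x * y) (x * z) = c.lam x y z - c.lam x z y := by
  induction x using Pi0.ind with | _ X
  induction y using Pi0.ind with | _ Y
  induction z using Pi0.ind with | _ Z
  have h := congrArg val (AnnCategory.distribL_addComm X Y Z)
  simp only [val_comp, c.val_mulMap, val_id, smul_zero] at h
  simp only [← cl_mul, eta_cl, etaObj, lam_cl, lamObj, smul_add, smul_sub]
  linear_combination (norm := abel) -h

theorem rho_eta (x y z : Pi0 A) :
    c.eta x y <• z - c.eta (x * z) (y * z) = c.rho x y z - c.rho y x z := by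
  induction x using Pi0.ind with | _ X
  induction y using Pi0.ind with | _ Y
  induction z using Pi0.ind with | _ Z
  have h := congrArg val (AnnCategory.distribR_addComm X Y Z)
  simp only [val_comp, c.val_mulMap, val_id, smul_zero] at h
  simp only [← cl_mul, eta_cl, etaObj, rho_cl, rhoObj, smul_add, smul_sub]
  linear_combination (norm := abel) -h

theorem lam_xi (x y z t : Pi0 A) : x • c.xi y z t - c.xi (x * y) (x * z) (x * t) =
    c.lam x z t - c.lam x (y + z) t + c.lam x y (z + t) - c.lam x y z := by
  induction x using Pi0.ind with | _ X
  induction y using Pi0.ind with | _ Y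
  induction z using Pi0.ind with | _ Z
  induction t using Pi0.ind with | _ T
  have h := congrArg val (AnnCategory.distribL_addAssoc X Y Z T)
  simp only [val_comp, c.val_mulMap, c.val_addMap, val_id, smul_zero] at h
  simp only [← cl_mul, ← cl_add, xi_cl, xiObj, lam_cl, lamObj, smul_add, smul_sub]
  linear_combination (norm := abel) -h

theorem rho_xi (x y z t : Pi0 A) : c.xi x y z <• t - c.xi (x * t) (y * t) (z * t) =
    c.rho y z t - c.rho (x + y) z t + c.rho x (y + z) t - c.rho x y t := by
  induction x using Pi0.ind with | _ X
  induction y using Pi0.ind with | _ Y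
  induction z using Pi0.ind with | _ Z
  induction t using Pi0.ind with | _ T
  have h := congrArg val (AnnCategory.distribR_addAssoc X Y Z T)
  simp only [val_comp, c.val_mulMap, c.val_addMap, val_id, smul_zero] at h
  simp only [← cl_mul, ← cl_add, xi_cl, xiObj, rho_cl, rhoObj, smul_add, smul_sub]
  linear_combination (norm := abel) -h

/-- The cochain terms are brought into the form in which they occur in the relation between `λ` and
`ρ`. Expanding the definition of the interchange gives a different expression, and two pentagons
with the antisymmetry of `η` convert one into the other. -/
theorem val_interchange (X Y Z T : A) : val (interchange X Y Z T) =
    c.add (X ⊕ₒ Y) (Z ⊕ₒ T) + c.add X Y + c.add Z T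
      - c.add (X ⊕ₒ Z) (Y ⊕ₒ T) - c.add X Z - c.add Y T
      - c.xi (cl X + cl Z) (cl Y) (cl T) + c.xi (cl X) (cl Z) (cl Y) - c.eta (cl Z) (cl Y)
      + c.xi (cl X + cl Y) (cl Z) (cl T) - c.xi (cl X) (cl Y) (cl Z) := by
  have h1 := c.xi_pentagon (cl X) (cl Y) (cl Z) (cl T)
  have h2 := c.xi_pentagon (cl X) (cl Z) (cl Y) (cl T)
  have h3 := c.eta_symm (cl Y) (cl Z)
  rw [add_comm (cl Z) (cl Y)] at h2
  have e : val (interchange X Y Z T) =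
      c.add (X ⊕ₒ Y) (Z ⊕ₒ T) + c.add X Y + c.add Z T
      - c.add (X ⊕ₒ Z) (Y ⊕ₒ T) - c.add X Z - c.add Y T
      - c.xi (cl X) (cl Y) (cl Z + cl T) + c.xi (cl Y) (cl Z) (cl T) + c.eta (cl Y) (cl Z)
      - c.xi (cl Z) (cl Y) (cl T) + c.xi (cl X) (cl Z) (cl Y + cl T) := by
    simp only [interchange_eq, val_comp, c.val_addMap, val_id, val_inv, ← cl_add, xi_cl, xiObj,
      eta_cl, etaObj]
    abel
  linear_combination (norm := abel) e + h1 - h2 + h3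

theorem lam_rho (x y z t : Pi0 A) :
    c.rho x y (z + t) - c.rho x y z - c.rho x y t + c.lam x z t + c.lam y z t - c.lam (x + y) z t =
      -c.xi (x * z + x * t) (y * z) (y * t) + c.xi (x * z) (x * t) (y * z)
        - c.eta (x * t) (y * z) + c.xi (x * z + y * z) (x * t) (y * t)
        - c.xi (x * z) (y * z) (x * t) := by
  induction x using Pi0.ind with | _ X
  induction y using Pi0.ind with | _ Y
  induction z using Pi0.ind with | _ Z
  induction t using Pi0.ind with | _ T
  have h := congrArg val (AnnCategory.distribL_distribR X Y Z T)
  simp only [val_comp, c.val_addMap, c.val_interchange, cl_mul] at h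
  simp only [← cl_add, rho_cl, rhoObj, lam_cl, lamObj]
  simp only [cl_add, add_smul, MulOpposite.op_add]
  linear_combination (norm := abel) -h

theorem al_lam (x y z t : Pi0 A) : c.al x y (z + t) - c.al x y z - c.al x y t =
    x • c.lam y z t + c.lam x (y * z) (y * t) - c.lam (x * y) z t := by
  induction x using Pi0.ind with | _ X
  induction y using Pi0.ind with | _ Y
  induction z using Pi0.ind with | _ Z
  induction t using Pi0.ind with | _ T
  have h := congrArg val (AnnCategory.mulAssoc_distribL X Y Z T)
  simp only [val_comp, c.val_mulMap, c.val_addMap, val_id, smul_zero] at h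
  -- Sums and products of classes are first folded into classes of objects, so that the cochains can
  -- be evaluated, and then unfolded again, so that the actions can be expanded.
  simp only [← cl_add, ← cl_mul, al_cl, alObj, lam_cl, lamObj]
  simp only [cl_add, cl_mul, add_smul, mul_smul, MulOpposite.op_add, smul_add, smul_sub]
  linear_combination (norm := abel) h

theorem al_lam_rho (x y z t : Pi0 A) : c.al x (y + z) t - c.al x y t - c.al x z t =
    x • c.rho y z t - c.rho (x * y) (x * z) t + c.lam x (y * t) (z * t) - c.lam x y z <• t := by
  induction x using Pi0.ind with | _ X
  induction y using Pi0.ind with | _ Y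
  induction z using Pi0.ind with | _ Z
  induction t using Pi0.ind with | _ T
  have h := congrArg val (AnnCategory.mulAssoc_distribL_distribR X Y Z T)
  simp only [val_comp, c.val_mulMap, c.val_addMap, val_id, smul_zero] at h
  simp only [← cl_add, ← cl_mul, al_cl, alObj, lam_cl, lamObj, rho_cl, rhoObj]
  -- The bimodule law is needed here: the correction of the middle pair of factors is acted on from
  -- both sides, in either order.
  simp only [cl_add, cl_mul, add_smul, mul_smul, MulOpposite.op_add, smul_add, smul_sub,
    smul_comm (cl X) (MulOpposite.op (cl T))]
  linear_combination (norm := abel) h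

theorem al_rho (x y z t : Pi0 A) : c.al (x + y) z t - c.al x z t - c.al y z t =
    -(c.rho x y z <• t) - c.rho (x * z) (y * z) t + c.rho x y (z * t) := by
  induction x using Pi0.ind with | _ X
  induction y using Pi0.ind with | _ Y
  induction z using Pi0.ind with | _ Z
  induction t using Pi0.ind with | _ T
  have h := congrArg val (AnnCategory.mulAssoc_distribR X Y Z T)
  simp only [val_comp, c.val_mulMap, c.val_addMap, val_id, smul_zero] at h
  simp only [← cl_add, ← cl_mul, al_cl, alObj, rho_cl, rhoObj]
  simp only [cl_add, cl_mul, add_smul, mul_smul, MulOpposite.op_mul, smul_add, smul_sub]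
  linear_combination (norm := abel) h

theorem al_pentagon (x y z t : Pi0 A) :
    x • c.al y z t - c.al (x * y) z t + c.al x (y * z) t - c.al x y (z * t)
      + c.al x y z <• t = 0 := by
  induction x using Pi0.ind with | _ X
  induction y using Pi0.ind with | _ Y
  induction z using Pi0.ind with | _ Z
  induction t using Pi0.ind with | _ T
  have h := congrArg val (mul_pentagon X Y Z T)
  simp only [val_comp, c.val_mulMap, val_id, smul_zero] at h
  simp only [← cl_mul, al_cl, alObj]
  simp only [cl_mul, mul_smul, MulOpposite.op_mul, smul_add, smul_sub,
    smul_comm (cl X) (MulOpposite.op (cl T))]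
  linear_combination (norm := abel) h

end Correction

end Corrections

/-! ### Normalising the correction at the units. -/

section Normalisation

variable {A : Type u} [Category.{v} A] [AnnCategory A]

namespace Correction

variable (c : Correction A)

/-- change of a correction by functions on pairs of classes -/
def shift (b b' : Pi0 A → Pi0 A → Pi1 A) : Correction A where
  add X Y := c.add X Y + b (cl X) (cl Y)
  mul X Y := c.mul X Y + b' (cl X) (cl Y)
  add_naturality f g := by
    rw [cl_eq_of_hom f, cl_eq_of_hom g, ← add_assoc, c.add_naturality, add_right_comm]
  mul_naturality f g := by
    rw [← add_assoc, c.mul_naturality, add_right_comm, cl_eq_of_hom f, cl_eq_of_hom g]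

theorem shift_add (b b' : Pi0 A → Pi0 A → Pi1 A) (X Y : A) :
    (c.shift b b').add X Y = c.add X Y + b (cl X) (cl Y) := rfl

theorem shift_mul (b b' : Pi0 A → Pi0 A → Pi1 A) (X Y : A) :
    (c.shift b b').mul X Y = c.mul X Y + b' (cl X) (cl Y) := rfl

/-- The effect on the cochain is a coboundary: `b'` enters through its failure to be additive in the
second variable, `b` through its failure to commute with the left action of `x`. -/
theorem lam_shift (b b' : Pi0 A → Pi0 A → Pi1 A) (x y z : Pi0 A) :
    (c.shift b b').lam x y z = c.lam x y z + b (x * y) (x * z) + b' x y + b' x z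
      - b' x (y + z) - x • b y z := by
  induction x using Pi0.ind with | _ X
  induction y using Pi0.ind with | _ Y
  induction z using Pi0.ind with | _ Z
  simp only [lam_cl, lamObj, shift_add, shift_mul, smul_add, cl_add, cl_mul]
  abel

theorem rho_shift (b b' : Pi0 A → Pi0 A → Pi1 A) (x y z : Pi0 A) :
    (c.shift b b').rho x y z = c.rho x y z + b (x * z) (y * z) + b' x z + b' y z
      - b' (x + y) z - b x y <• z := by
  induction x using Pi0.ind with | _ X
  induction y using Pi0.ind with | _ Y
  induction z using Pi0.ind with | _ Z
  simp only [rho_cl, rhoObj, shift_add, shift_mul, smul_add, cl_add, cl_mul]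
  abel

/-- The correction is compatible with the unit constraints. -/
structure IsUnital : Prop where
  zero_add : ∀ Y : A, c.add (zeroObj A) Y = val (zeroAdd Y).hom
  add_zero : ∀ X : A, c.add X (zeroObj A) = val (addZero X).hom
  one_mul : ∀ Y : A, c.mul (oneObj A) Y = val (oneMul Y).hom
  mul_one : ∀ X : A, c.mul X (oneObj A) = val (mulOne X).hom

end Correction

open scoped Classical in
/-- Functions of one class extend to a function of two classes with prescribed restrictions to
the lines `x = e` and `y = e`. -/
theorem exists_extension {p q : A → Pi1 A} (e : A)
    (hp : ∀ {X Y : A}, (X ⟶ Y) → p X = p Y) (hq : ∀ {X Y : A}, (X ⟶ Y) → q X = q Y)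
    -- The two lines meet at the class of `e`, where both prescriptions apply.
    (he : p e = q e) :
    ∃ b : Pi0 A → Pi0 A → Pi1 A, ∀ X : A, b (cl e) (cl X) = p X ∧ b (cl X) (cl e) = q X := by
  refine ⟨fun x y => if x = cl e then p (rep y) else if y = cl e then q (rep x) else 0,
    fun X => ⟨?_, ?_⟩⟩
  · dsimp only
    rw [if_pos rfl]
    exact (hp (bridgeRep X rfl)).symm
  · by_cases h : cl X = cl e
    · dsimp only
      rw [if_pos h, ← hp (bridgeRep e rfl), he]
      exact hq (bridge h.symm)
    · dsimp only
      rw [if_neg h, if_pos rfl]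
      exact (hq (bridgeRep X rfl)).symm

/-- The difference between a unit constraint and the correction is a function of the class, by
naturality of the constraint. The left and right differences agree at the unit because the two unit
constraints coincide there, so a single shift removes both. -/
theorem exists_isUnital : ∃ c : Correction A, c.IsUnital := by
  obtain ⟨c⟩ := exists_correction (A := A)
  obtain ⟨b, hb⟩ := exists_extension (zeroObj A)
    (p := fun Y => val (zeroAdd Y).hom - c.add (zeroObj A) Y)
    (q := fun X => val (addZero X).hom - c.add X (zeroObj A))
    (fun {X Y} f => by
      have h := congrArg val (zeroAdd_naturality f)
      simp only [val_comp, c.val_addMap, val_id] at h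
      linear_combination (norm := abel) -h)
    (fun {X Y} f => by
      have h := congrArg val (addZero_naturality f)
      simp only [val_comp, c.val_addMap, val_id] at h
      linear_combination (norm := abel) -h)
    (by rw [zeroAdd_zeroObj])
  obtain ⟨b', hb'⟩ := exists_extension (oneObj A)
    (p := fun Y => val (oneMul Y).hom - c.mul (oneObj A) Y)
    (q := fun X => val (mulOne X).hom - c.mul X (oneObj A))
    (fun {X Y} f => by
      have h := congrArg val (oneMul_naturality f)
      simp only [val_comp, c.val_mulMap, val_id, smul_zero, cl_one, one_smul] at h
      linear_combination (norm := abel) -h)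
    (fun {X Y} f => by
      have h := congrArg val (mulOne_naturality f)
      simp only [val_comp, c.val_mulMap, val_id, smul_zero, cl_one, MulOpposite.op_one,
        one_smul] at h
      linear_combination (norm := abel) -h)
    (by rw [oneMul_oneObj])
  refine ⟨c.shift b b', fun Y => ?_, fun X => ?_, fun Y => ?_, fun X => ?_⟩
  · rw [Correction.shift_add, (hb Y).1, add_sub_cancel]
  · rw [Correction.shift_add, (hb X).2, add_sub_cancel]
  · rw [Correction.shift_mul, (hb' Y).1, add_sub_cancel]
  · rw [Correction.shift_mul, (hb' X).2, add_sub_cancel]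

namespace Correction.IsUnital

variable {c : Correction A} (hc : c.IsUnital)

include hc

theorem xi_zero_mid (x t : Pi0 A) : c.xi x 0 t = 0 := by
  induction x using Pi0.ind with | _ X
  induction t using Pi0.ind with | _ T
  have h := congrArg val (add_triangle X T)
  simp only [val_comp, c.val_addMap, val_id] at h
  rw [← cl_zero, xi_cl, xiObj, hc.add_zero, hc.zero_add]
  linear_combination (norm := abel) h

/-- With two adjacent zeros, the pentagon leaves one copy of the wanted term besides terms with `0`
in the middle. -/
theorem xi_zero_left (y z : Pi0 A) : c.xi 0 y z = 0 := by
  have h := c.xi_pentagon 0 0 y z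
  simpa [hc.xi_zero_mid] using h

theorem xi_zero_right (x y : Pi0 A) : c.xi x y 0 = 0 := by
  have h := c.xi_pentagon x y 0 0
  simpa [hc.xi_zero_mid] using h

theorem lam_one (y z : Pi0 A) : c.lam 1 y z = 0 := by
  induction y using Pi0.ind with | _ Y
  induction z using Pi0.ind with | _ Z
  have h := congrArg val (AnnCategory.distribL_one Y Z)
  simp only [val_comp, c.val_addMap] at h
  rw [← cl_one, lam_cl, lamObj, hc.one_mul, hc.one_mul, hc.one_mul, cl_one, one_smul]
  linear_combination (norm := abel) h

theorem rho_one (x y : Pi0 A) : c.rho x y 1 = 0 := by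
  induction x using Pi0.ind with | _ X
  induction y using Pi0.ind with | _ Y
  have h := congrArg val (AnnCategory.distribR_one X Y)
  simp only [val_comp, c.val_addMap] at h
  rw [← cl_one, rho_cl, rhoObj, hc.mul_one, hc.mul_one, hc.mul_one, cl_one, MulOpposite.op_one,
    one_smul]
  linear_combination (norm := abel) h

theorem al_one_left (y z : Pi0 A) : c.al 1 y z = 0 := by
  induction y using Pi0.ind with | _ Y
  induction z using Pi0.ind with | _ Z
  have h := congrArg val (mulAssoc_oneMul Y Z)
  simp only [val_comp, c.val_mulMap, val_id, smul_zero] at h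
  rw [← cl_one, al_cl, alObj, hc.one_mul, hc.one_mul, cl_one, one_smul]
  linear_combination (norm := abel) h

theorem al_one_mid (x z : Pi0 A) : c.al x 1 z = 0 := by
  induction x using Pi0.ind with | _ X
  induction z using Pi0.ind with | _ Z
  have h := congrArg val (mul_triangle X Z)
  simp only [val_comp, c.val_mulMap, val_id, smul_zero] at h
  rw [← cl_one, al_cl, alObj, hc.one_mul, hc.mul_one]
  linear_combination (norm := abel) h

theorem al_one_right (x y : Pi0 A) : c.al x y 1 = 0 := by
  induction x using Pi0.ind with | _ X
  induction y using Pi0.ind with | _ Y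
  have h := congrArg val (mulAssoc_mulOne X Y)
  simp only [val_comp, c.val_mulMap, val_id, smul_zero] at h
  rw [← cl_one, al_cl, alObj, hc.mul_one, hc.mul_one, cl_one, MulOpposite.op_one, one_smul]
  linear_combination (norm := abel) h

/-- Antisymmetry would only give that twice this element vanishes; the hexagon gives the element
itself. -/
theorem eta_zero_zero : c.eta 0 0 = 0 := by
  have h := c.xi_eta_hexagon 0 0 0
  simpa [hc.xi_zero_mid] using h

/-- The compatibility of the two distributivities at zero. It lets one shift of `mul` satisfy both
prescriptions on the lines `x = 0` and `y = 0`. -/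
theorem lam_zero_eq_rho_zero : c.lam 0 0 0 = c.rho 0 0 0 := by
  have h := c.lam_rho 0 0 0 0
  rw [_root_.add_zero, mul_zero, _root_.add_zero, hc.xi_zero_mid, hc.eta_zero_zero] at h
  linear_combination (norm := abel) h

end Correction.IsUnital

theorem Pi1.eq_zero_of_one_eq_zero (h : (1 : Pi0 A) = 0) (u : Pi1 A) : u = 0 := by
  rw [← one_smul (Pi0 A) u, h, zero_smul]

/-- The correction is compatible with the unit constraints and, in addition, with the
isomorphisms `0 ⊗ X ≅ 0` and `X ⊗ 0 ≅ 0` that come from distributivity. -/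
structure Correction.IsNormal (c : Correction A) : Prop extends c.IsUnital where
  rho_zero_zero : ∀ z, c.rho 0 0 z = 0
  lam_zero_zero : ∀ x, c.lam x 0 0 = 0

open scoped Classical in
-- Shifting `mul` by `b` adds `b 0 z` to `ρ(0,0,z)` and `b x 0` to `λ(x,0,0)`, which dictates `b` on
-- the two lines through zero. Elsewhere `b` is zero, and compatibility with `1` survives because
-- `λ(1,0,0)` and `ρ(0,0,1)` already vanish.
theorem exists_isNormal : ∃ c : Correction A, c.IsNormal := by
  obtain ⟨c, hc⟩ := exists_isUnital (A := A)
  let b (x y : Pi0 A) : Pi1 A := if x = 0 then -c.rho 0 0 y else if y = 0 then -c.lam x 0 0 else 0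
  have b_zero_left (y) : b 0 y = -c.rho 0 0 y := if_pos rfl
  have b_zero_right (x) : b x 0 = -c.lam x 0 0 := by
    by_cases h : x = 0
    · rw [h, b_zero_left, hc.lam_zero_eq_rho_zero]
    · simp only [b, if_neg h, if_true]
  have b_one_left (y) : b 1 y = 0 := by
    -- In the zero ring the lines `x = 0` and `x = 1` coincide, but then `Π₁` is zero as well.
    by_cases h : (1 : Pi0 A) = 0
    · exact Pi1.eq_zero_of_one_eq_zero h _
    · by_cases hy : y = 0
      · rw [hy, b_zero_right, hc.lam_one, neg_zero]
      · simp only [b, if_neg h, if_neg hy]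
  have b_one_right (x) : b x 1 = 0 := by
    by_cases h : (1 : Pi0 A) = 0
    · exact Pi1.eq_zero_of_one_eq_zero h _
    · by_cases hx : x = 0
      · rw [hx, b_zero_left, hc.rho_one, neg_zero]
      · simp only [b, if_neg h, if_neg hx]
  refine ⟨c.shift 0 b, ⟨fun Y => ?_, fun X => ?_, fun Y => ?_, fun X => ?_⟩, fun z => ?_,
    fun x => ?_⟩
  · exact (add_zero _).trans (hc.zero_add Y)
  · exact (add_zero _).trans (hc.add_zero X)
  · rw [Correction.shift_mul, cl_one, b_one_left, add_zero, hc.one_mul]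
  · rw [Correction.shift_mul, cl_one, b_one_right, add_zero, hc.mul_one]
  · simp [c.rho_shift, b_zero_left]
  · simp [c.lam_shift, b_zero_right]

/-! ### Vanishing at zero, from the relations with zeros put in. -/

namespace Correction.IsNormal

variable {c : Correction A} (hc : c.IsNormal)

include hc

theorem rho_zero_left (y z : Pi0 A) : c.rho 0 y z = 0 := by
  have h := c.rho_xi 0 0 y z
  simpa [hc.xi_zero_left, hc.rho_zero_zero] using h.symm

theorem rho_zero_mid (x z : Pi0 A) : c.rho x 0 z = 0 := by
  have h := c.rho_xi x 0 0 z
  simpa [hc.xi_zero_mid, hc.rho_zero_zero] using h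

theorem lam_zero_mid (x z : Pi0 A) : c.lam x 0 z = 0 := by
  have h := c.lam_xi x 0 0 z
  simpa [hc.xi_zero_left, hc.lam_zero_zero] using h.symm

theorem lam_zero_right (x y : Pi0 A) : c.lam x y 0 = 0 := by
  have h := c.lam_xi x y 0 0
  simpa [hc.xi_zero_mid, hc.lam_zero_zero] using h

/-- In the relation between `λ` and `ρ` at `0, 0, y, z` the terms in `λ` add up to a single one, and
everything else is already known to vanish. -/
theorem lam_zero_left (y z : Pi0 A) : c.lam 0 y z = 0 := by
  have h := c.lam_rho 0 0 y z
  simpa [hc.xi_zero_mid, hc.rho_zero_zero, hc.eta_zero_zero] using h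

theorem rho_zero_right (x y : Pi0 A) : c.rho x y 0 = 0 := by
  have h := c.lam_rho x y 0 0
  simpa [hc.xi_zero_mid, hc.lam_zero_zero, hc.eta_zero_zero] using h

theorem al_zero_right (x y : Pi0 A) : c.al x y 0 = 0 := by
  have h := c.al_lam x y 0 0
  simpa [hc.lam_zero_zero] using h

theorem al_zero_mid (x z : Pi0 A) : c.al x 0 z = 0 := by
  have h := c.al_lam_rho x 0 0 z
  simpa [hc.lam_zero_zero, hc.rho_zero_zero] using h

theorem al_zero_left (y z : Pi0 A) : c.al 0 y z = 0 := by
  have h := c.al_rho 0 0 y z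
  simpa [hc.rho_zero_zero] using h

end Correction.IsNormal

/-- the Ann-category of type `(Π₀, Π₁)` given by a normal correction -/
noncomputable def Correction.typeData (c : Correction A) (hc : c.IsNormal) :
    TypeData (Pi0 A) (Pi1 A) where
  ξ := c.xi
  η := c.eta
  α := c.al
  lam := c.lam
  rho := c.rho
  ξ_pentagon := c.xi_pentagon
  ξ_zero_left := hc.xi_zero_left
  ξ_zero_mid := hc.xi_zero_mid
  ξ_zero_right := hc.xi_zero_right
  ξ_η_hexagon := c.xi_eta_hexagon
  η_symm := c.eta_symm
  lam_η := c.lam_eta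
  rho_η := c.rho_eta
  lam_ξ := c.lam_xi
  rho_ξ := c.rho_xi
  lam_rho := c.lam_rho
  α_lam := c.al_lam
  α_lam_rho := c.al_lam_rho
  α_rho := c.al_rho
  α_pentagon := c.al_pentagon
  α_one_left := hc.al_one_left
  α_one_mid := hc.al_one_mid
  α_one_right := hc.al_one_right
  α_zero_left := hc.al_zero_left
  α_zero_mid := hc.al_zero_mid
  α_zero_right := hc.al_zero_right
  lam_one := hc.lam_one
  lam_zero_left := hc.lam_zero_left
  lam_zero_mid := hc.lam_zero_mid
  lam_zero_right := hc.lam_zero_right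
  rho_one := hc.rho_one
  rho_zero_left := hc.rho_zero_left
  rho_zero_mid := hc.rho_zero_mid
  rho_zero_right := hc.rho_zero_right

/-- the functor `X ↦ cl X`, `f ↦ val f` -/
noncomputable def classFunctor (f : TypeData (Pi0 A) (Pi1 A)) : A ⥤ TypeCat f where
  obj X := ⟨cl X⟩
  map p := ⟨val p, cl_eq_of_hom p⟩
  map_id X := typeHom_ext (val_id X)
  map_comp p q := typeHom_ext (val_comp p q)

instance (f : TypeData (Pi0 A) (Pi1 A)) : (classFunctor f).Faithful where
  map_injective h := val_injective (congrArg TypeHom.val h)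

instance (f : TypeData (Pi0 A) (Pi1 A)) : (classFunctor f).Full where
  map_surjective p :=
    let ⟨q, hq⟩ := val_surjective (typeHom_eq p) (TypeHom.val p)
    ⟨q, typeHom_ext hq⟩

instance (f : TypeData (Pi0 A) (Pi1 A)) : (classFunctor f).EssSurj where
  mem_essImage x := ⟨rep x.toR, ⟨typeIso (cl_rep x.toR) 0⟩⟩

instance (f : TypeData (Pi0 A) (Pi1 A)) : (classFunctor f).IsEquivalence where

/-- The class functor is an Ann-functor, with structure isomorphisms given by the correction. -/
noncomputable def Correction.annFunctor (c : Correction A) (hc : c.IsNormal) :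
    AnnFunctor A (TypeCat (c.typeData hc)) where
  __ := classFunctor (c.typeData hc)
  mapAdd X Y := typeIso (cl_add X Y) (c.add X Y)
  mapMul X Y := typeIso (cl_mul X Y) (c.mul X Y)
  mapAdd_naturality p q := typeHom_ext (c.add_naturality p q)
  mapMul_naturality p q := typeHom_ext (c.mul_naturality p q)
  map_addAssoc X Y Z := typeHom_ext <| by
    -- In coordinates the diagram is the definition of `xiObj` rearranged. The double negation
    -- arises because `a⁺` is the inverse of the monoidal associator, whose coordinate is `-ξ`.
    change c.add X (Y ⊕ₒ Z) + (0 + c.add Y Z + - -c.xi (cl X) (cl Y) (cl Z)) =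
      val (addAssoc X Y Z).hom + (c.add (X ⊕ₒ Y) Z + (c.add X Y + 0))
    rw [c.xi_cl, xiObj]
    abel
  map_addComm X Y := typeHom_ext <| by
    change c.add X Y + c.eta (cl X) (cl Y) = val (addComm X Y).hom + c.add Y X
    rw [c.eta_cl, etaObj]
    abel
  map_mulAssoc X Y Z := typeHom_ext <| by
    change c.mul X (Y ⊗ₒ Z) + (cl X • c.mul Y Z + (0 : Pi1 A) <• cl (Y ⊗ₒ Z) +
        - -c.al (cl X) (cl Y) (cl Z)) =
      val (mulAssoc X Y Z).hom + (c.mul (X ⊗ₒ Y) Z +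
        (cl (X ⊗ₒ Y) • (0 : Pi1 A) + c.mul X Y <• cl Z))
    rw [c.al_cl, alObj, smul_zero, smul_zero]
    abel
  map_distribL X Y Z := typeHom_ext <| by
    change c.mul X (Y ⊕ₒ Z) + (cl X • c.add Y Z + (0 : Pi1 A) <• cl (Y ⊕ₒ Z) +
        c.lam (cl X) (cl Y) (cl Z)) =
      val (AnnCategory.distribL X Y Z).hom + (c.add (X ⊗ₒ Y) (X ⊗ₒ Z) + (c.mul X Y + c.mul X Z))
    rw [c.lam_cl, lamObj, smul_zero]
    abel
  map_distribR X Y Z := typeHom_ext <| by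
    change c.mul (X ⊕ₒ Y) Z + (cl (X ⊕ₒ Y) • (0 : Pi1 A) + c.add X Y <• cl Z +
        c.rho (cl X) (cl Y) (cl Z)) =
      val (AnnCategory.distribR X Y Z).hom + (c.add (X ⊗ₒ Z) (Y ⊗ₒ Z) + (c.mul X Z + c.mul Y Z))
    rw [c.rho_cl, rhoObj, smul_zero]
    abel

end Normalisation

end Ann

theorem theorem3p3 (A : Type u) [Category.{v} A] [Ann.AnnCategory A] :
    ∃ f : Ann.TypeData (Ann.Pi0 A) (Ann.Pi1 A), Ann.AnnEquivalent A (Ann.TypeCat f) := by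
  obtain ⟨c, hc⟩ := Ann.exists_isNormal (A := A)
  exact ⟨c.typeData hc, c.annFunctor hc,
    inferInstanceAs (Ann.classFunctor (c.typeData hc)).IsEquivalence⟩
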